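/- Let $d\ge 1$, let $\mathbf E\subset\mathbb R^d$ be a compact convex set with non-empty interior, let $C\subseteq\mathbf E$ be a closed convex set of Lebesgue measure $|C|>0$, and let $\lambda>0$. Let $\mathcal N$ be a Poisson point process of intensity $\lambda$ on $C$, defined on a probability space $(\Omega,\mathcal A,\mathbb P)$: a measurable map from $\Omega$ to the space of $\mathbb N$-valued measures on the Borel sets of $\mathbf E$ such that $\mathcal N(A)\sim\mathrm{Poiss}(\lambda|A\cap C|)$ for every Borel set $A\subseteq\mathbf E$ and $\mathcal N(A_1),\dots,\mathcal N(A_n)$ are independent for mutually disjoint Borel sets $A_1,\dots,A_n\subseteq\mathbf E$. Let $\mathfrak F=\sigma(\mathcal N(U): U\subseteq\mathbf E\text{ compact})$. For compact $K\subseteq\mathbf E$ let $\mathcal F_K$ be the $\sigma$-algebra generated by the variables $\mathcal N(U)$, $U\subseteq K$ compact, completed with the $\mathbb P$-null sets in $\mathfrak F$. A stopping set is a random compact set $\mathcal K\subseteq\mathbf E$ (an $\mathfrak F$-measurable map into the compact subsets of $\mathbf E$, with the Borel $\sigma$-algebra of the Hausdorff metric) such that $\{\mathcal K\subseteq K\}\in\mathcal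 F_K$ for all compact $K\subseteq\mathbf E$; its history is $$\mathcal F_{\mathcal K}=\{A\in\mathfrak F:\ A\cap\{\mathcal K\subseteq K\}\in\mathcal F_K\ \text{ for all compact } K\subseteq\mathbf E\}.$$ Let $\hat C$ be the convex hull of the points of $\mathcal N$, let $\hat{\mathcal K}=\overline{\mathbf E\setminus\hat C}$, and let $N_\partial=\mathcal N(\partial\hat C)$ and $N_\circ=\mathcal N(\hat C^{\circ})$ be the numbers of points of $\mathcal N$ on the boundary and in the interior of $\hat C$. Then $\hat{\mathcal K}$ is a stopping set, and: (i) $N_\partial$ is $\mathcal F_{\hat{\mathcal K}}$-measurable; (ii) $N_\circ$ is a random variable which, conditionally on $\mathcal F_{\hat{\mathcal K}}$, is Poisson distributed with parameter $\lambda|\hat C|$, that is, for every $k\in\{0,1,2,\dots\}$, almost surely $$\mathbb P\bigl(N_\circ=k\,\big|\,\mathcal F_{\hat{\mathcal K}}\bigr)=e^{-\lambda|\hat C|}\,\frac{(\lambda|\hat C|)^k}{k!};$$ (iii) $\mathcal F_{\hat{\mathcal K}}=\sigma(\hat C)$, where $\sigma(\hat C)$ denotes the $\sigma$-algebra generated by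 the events $\{\hat C\subseteq B\}$, $B\subseteq\mathbf E$ closed and convex, completed with the $\mathbb P$-null sets in $\mathfrak F$. -/

import Mathlib

open MeasureTheory ProbabilityTheory TopologicalSpace
open scoped NNReal ENNReal

noncomputable section

namespace HullPPP

variable {d : ℕ} {Ω : Type*}

/-- The point measures on a compact state space `E ⊆ ℝᵈ`: the measures on the Borel sets of `E`
(viewed as Borel measures on `ℝᵈ` that vanish off `E`) all of whose values are natural numbers.
As a subtype of `Measure`, it carries the σ-algebra generated by the evaluations `m ↦ m A`. -/
abbrev PointMeasure (E : Compacts (EuclideanSpace ℝ (Fin d))) : Type :=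
  {m : Measure (EuclideanSpace ℝ (Fin d)) //
    m (E : Set (EuclideanSpace ℝ (Fin d)))ᶜ = 0 ∧
      ∀ A : Set (EuclideanSpace ℝ (Fin d)), MeasurableSet A → ∃ n : ℕ, m A = n}

variable {E : Compacts (EuclideanSpace ℝ (Fin d))}

/-- `𝒩` is a Poisson point process of intensity `lam` on `C`, with state space `E`. -/
structure IsPoissonPointProcess [MeasurableSpace Ω] (P : Measure Ω) (lam : ℝ≥0)
    (C : Set (EuclideanSpace ℝ (Fin d))) (𝒩 : Ω → PointMeasure E) : Prop where
  measurable : Measurable 𝒩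
  law : ∀ A : Set (EuclideanSpace ℝ (Fin d)), MeasurableSet A → A ⊆ E →
    P.map (fun ω => (𝒩 ω).1 A) =
      (poissonMeasure (lam * (volume (A ∩ C)).toNNReal)).map (Nat.cast : ℕ → ℝ≥0∞)
  indep : ∀ (n : ℕ) (A : Fin n → Set (EuclideanSpace ℝ (Fin d))),
    (∀ i, MeasurableSet (A i)) → (∀ i, A i ⊆ E) → Pairwise (fun i j => Disjoint (A i) (A j)) →
      iIndepFun (fun i ω => (𝒩 ω).1 (A i)) P

/-- The convex hull of the points (the atoms) of a point measure. -/
def hull (m : PointMeasure E) : Set (EuclideanSpace ℝ (Fin d)) :=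
  convexHull ℝ {x | m.1 {x} ≠ 0}

/-- The closure of the complement (in the state space `E`) of the convex hull. -/
def closedCompl (m : PointMeasure E) : Compacts (EuclideanSpace ℝ (Fin d)) where
  carrier := closure ((E : Set (EuclideanSpace ℝ (Fin d))) \ hull m)
  isCompact' := E.isCompact.closure_of_subset Set.sdiff_subset

/-- The number of points on the boundary of the convex hull. -/
def boundaryCount (m : PointMeasure E) : ℝ≥0∞ := m.1 (frontier (hull m))

/-- The number of points in the interior of the convex hull. -/
def interiorCount (m : PointMeasure E) : ℝ≥0∞ := m.1 (interior (hull m))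

/-- The σ-algebra `σ(𝒩(U) : U ⊆ K, U compact)`. -/
def countSigma (𝒩 : Ω → PointMeasure E) (K : Compacts (EuclideanSpace ℝ (Fin d))) :
    MeasurableSpace Ω :=
  ⨆ (U : Compacts (EuclideanSpace ℝ (Fin d))) (_ : U ≤ K),
    MeasurableSpace.comap (fun ω => (𝒩 ω).1 (U : Set (EuclideanSpace ℝ (Fin d)))) inferInstance

/-- The σ-algebra `m` completed with the null sets in `𝔉`, where `𝔉` is generated by the whole
process `(𝒩(K), K ⊆ E compact)`. -/
def complete [MeasurableSpace Ω] (P : Measure Ω) (𝒩 : Ω → PointMeasure E)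
    (m : MeasurableSpace Ω) : MeasurableSpace Ω :=
  m ⊔ MeasurableSpace.generateFrom {Z | MeasurableSet[countSigma 𝒩 E] Z ∧ P Z = 0}

/-- The natural set-indexed filtration of the process, completed with the null sets. -/
def natFiltration [MeasurableSpace Ω] (P : Measure Ω) (𝒩 : Ω → PointMeasure E)
    (K : Compacts (EuclideanSpace ℝ (Fin d))) : MeasurableSpace Ω :=
  complete P 𝒩 (countSigma 𝒩 K)

/-- The σ-algebra `σ(𝓕 K : K ⊆ E compact)` generated by a set-indexed filtration. -/
def totalSigma (E : Compacts (EuclideanSpace ℝ (Fin d)))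
    (𝓕 : Compacts (EuclideanSpace ℝ (Fin d)) → MeasurableSpace Ω) : MeasurableSpace Ω :=
  ⨆ (K : Compacts (EuclideanSpace ℝ (Fin d))) (_ : K ≤ E), 𝓕 K

/-- A stopping set: a random compact subset `𝒦` of `E` (measurable for the Borel σ-algebra of the
Hausdorff metric on compact sets) such that `{𝒦 ⊆ K} ∈ 𝓕 K` for every compact `K ⊆ E`. -/
structure IsStoppingSet (E : Compacts (EuclideanSpace ℝ (Fin d)))
    (𝓕 : Compacts (EuclideanSpace ℝ (Fin d)) → MeasurableSpace Ω)
    (𝒦 : Ω → Compacts (EuclideanSpace ℝ (Fin d))) : Prop where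
  subset : ∀ ω, 𝒦 ω ≤ E
  measurable : @Measurable Ω _ (totalSigma E 𝓕) (borel _) 𝒦
  measurableSet_le : ∀ K ≤ E, MeasurableSet[𝓕 K] {ω | 𝒦 ω ≤ K}

/-- The σ-algebra of the history of a stopping set. -/
def IsStoppingSet.history {𝓕 : Compacts (EuclideanSpace ℝ (Fin d)) → MeasurableSpace Ω}
    {𝒦 : Ω → Compacts (EuclideanSpace ℝ (Fin d))} (h : IsStoppingSet E 𝓕 𝒦) :
    MeasurableSpace Ω where
  MeasurableSet' A := MeasurableSet[totalSigma E 𝓕] A ∧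
    ∀ K ≤ E, MeasurableSet[𝓕 K] (A ∩ {ω | 𝒦 ω ≤ K})
  measurableSet_empty :=
    ⟨@MeasurableSet.empty _ (_), fun K _ => by
      rw [Set.empty_inter]; exact @MeasurableSet.empty _ (_)⟩
  measurableSet_compl A hA :=
    ⟨@MeasurableSet.compl _ _ (_) hA.1, fun K hK => by
      have e : Aᶜ ∩ {ω | 𝒦 ω ≤ K} = {ω | 𝒦 ω ≤ K} \ (A ∩ {ω | 𝒦 ω ≤ K}) := by
        ext ω; simp only [Set.mem_inter_iff, Set.mem_compl_iff, Set.mem_sdiff]; tauto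
      rw [e]
      exact @MeasurableSet.diff _ (_) _ _ (h.measurableSet_le K hK) (hA.2 K hK)⟩
  measurableSet_iUnion f hf :=
    ⟨@MeasurableSet.iUnion _ _ (_) _ _ fun i => (hf i).1, fun K hK => by
      rw [Set.iUnion_inter]
      exact @MeasurableSet.iUnion _ _ (_) _ _ fun i => (hf i).2 K hK⟩

/-- The σ-algebra `σ({hull ⊆ B} : B ⊆ E closed convex)` completed with the null sets. -/
def hullSigma [MeasurableSpace Ω] (P : Measure Ω) (𝒩 : Ω → PointMeasure E) :
    MeasurableSpace Ω :=
  complete P 𝒩 (MeasurableSpace.generateFrom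
    {s | ∃ B : Set (EuclideanSpace ℝ (Fin d)), Convex ℝ B ∧ IsClosed B ∧ B ⊆ E ∧
      s = {ω | hull (𝒩 ω) ⊆ B}})

end HullPPP

end

/-!
Let `𝒦` be any stopping set. Removing from `E` those of the first `n` sets of a countable basis
which miss `𝒦` yields stopping sets with finitely many values which decrease to `𝒦`. On the event
that the `n`-th one equals `K`, an event of the history is determined by the points in `K`, which
are independent of the points in `E \ K`; hence, given the history, the points outside the `n`-th
set are Poisson. Letting `n → ∞` gives the same for the points outside `𝒦`, and shows that the
history is generated, up to null sets, by `𝒦` and the points in `𝒦`.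

The closed complement of the hull is a stopping set because almost surely it contains the vertices
of the hull, and these determine the hull. The points it contains are the points on the boundary
of the hull. Almost surely no two points coincide and, given the points outside a small cell, a
point of the cell avoids the boundary of their hull, which is a null set; so every point on the
boundary of the hull is a vertex. The points in the closed complement are thus a function of the
hull. It is a measurable one because the polytopes are a measurable image of the standard Borel
space of convexly independent tuples, on which the counting measure of the vertices is clearly
measurable.
-/

noncomputable section

namespace HullPPP

section Measurability

variable {X Y Z Ω : Type*} [MeasurableSpace X] [MeasurableSpace Y] [MeasurableSpace Z]

lemma measurable_measure_prodMk_preimage {κ : Z → Measure Y} (hκ : Measurable κ)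
    [∀ z, IsFiniteMeasure (κ z)] {S : Set (Z × Y)} (hS : MeasurableSet S) :
    Measurable fun z => κ z (Prod.mk z ⁻¹' S) := by
  suffices h : Measurable fun z => (κ z).map (Prod.mk z) by
    simpa only [Function.comp_def, Measure.map_apply measurable_prodMk_left hS] using
      (Measure.measurable_coe hS).comp h
  have hrect {s : Set Z} {t : Set Y} (hs : MeasurableSet s) (ht : MeasurableSet t) :
      Measurable fun z => (κ z).map (Prod.mk z) (s ×ˢ t) := by
    classical
    simp only [Measure.map_apply measurable_prodMk_left (hs.prod ht),
      Set.mk_preimage_prod_right_eq_if, apply_ite, measure_empty]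
    exact ((Measure.measurable_coe ht).comp hκ).ite hs measurable_const
  refine Measurable.measure_of_isPiSystem generateFrom_prod.symm isPiSystem_prod ?_ ?_
  · rintro _ ⟨s, hs, t, ht, rfl⟩
    exact hrect hs ht
  · rw [← Set.univ_prod_univ]
    exact hrect .univ .univ

lemma ae_measure_prodMk_preimage_eq_zero [MeasurableSpace Ω] {P : Measure Ω} [IsFiniteMeasure P]
    {R : Ω → X} {ζ : Ω → Z} (hR : Measurable R) (hζ : Measurable ζ) (hRζ : IndepFun R ζ P)
    {κ : Z → Measure Y} (hκ : Measurable κ) [∀ z, IsFiniteMeasure (κ z)] {S : Set (X × Y)}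
    (hS : MeasurableSet S) (h : ∀ x, ∀ᵐ ω ∂P, κ (ζ ω) (Prod.mk x ⁻¹' S) = 0) :
    ∀ᵐ ω ∂P, κ (ζ ω) (Prod.mk (R ω) ⁻¹' S) = 0 := by
  have hmeas : Measurable fun p : X × Z => κ p.2 (Prod.mk p.1 ⁻¹' S) :=
    measurable_measure_prodMk_preimage (κ := fun p : X × Z => κ p.2) (hκ.comp measurable_snd)
      (hS.preimage (f := fun q : (X × Z) × Y => (q.1.1, q.2)) (by fun_prop))
  have hnull : MeasurableSet {p : X × Z | κ p.2 (Prod.mk p.1 ⁻¹' S) ≠ 0} :=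
    (hmeas (measurableSet_singleton 0)).compl
  refine ae_of_ae_map (f := fun ω => (R ω, ζ ω)) (hR.prodMk hζ).aemeasurable
    (p := fun p => κ p.2 (Prod.mk p.1 ⁻¹' S) = 0) ?_
  rw [(indepFun_iff_map_prod_eq_prod_map_map hR.aemeasurable hζ.aemeasurable).1 hRζ, ae_iff,
    Measure.measure_prod_null hnull]
  refine .of_forall fun x => ?_
  exact ae_iff.1 ((ae_map_iff (p := fun z => κ z (Prod.mk x ⁻¹' S) = 0) hζ.aemeasurable
    (hmeas.comp measurable_prodMk_left (measurableSet_singleton 0))).2 (h x))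

lemma restrict_eq_of_forall_singleton [MeasurableSingletonClass X] {μ ν : Measure X} {s : Set X}
    (hs : s.Countable) (h : ∀ x ∈ s, μ {x} = ν {x}) : μ.restrict s = ν.restrict s := by
  rw [← Set.biUnion_of_singleton s, Measure.restrict_biUnion_congr hs]
  exact fun x hx => by rw [Measure.restrict_singleton, Measure.restrict_singleton, h x hx]

end Measurability

section Measures

lemma exists_disjoint_cover_measure_lt {X : Type*} [TopologicalSpace X] [SecondCountableTopology X]
    [Nonempty X] [MeasurableSpace X] [OpensMeasurableSpace X] (μ : Measure X) [μ.OuterRegular]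
    [NullSingletonClass μ] {ε : ℝ≥0∞} (hε : 0 < ε) :
    ∃ D : ℕ → Set X, (∀ n, MeasurableSet (D n)) ∧ Pairwise (Function.onFun Disjoint D) ∧
      ⋃ n, D n = Set.univ ∧ ∀ n, μ (D n) < ε := by
  have hnhds (x : X) : ∃ U, x ∈ U ∧ IsOpen U ∧ μ U < ε := by
    simpa only [Set.singleton_subset_iff] using
      Set.exists_isOpen_lt_of_lt {x} ε (by rwa [measure_singleton])
  choose U hxU hUo hUε using hnhds
  obtain ⟨s, hs, hsU⟩ := _root_.countable_cover_nhds fun x => (hUo x).mem_nhds (hxU x)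
  have hsne : s.Nonempty := by
    rw [Set.nonempty_iff_ne_empty]
    rintro rfl
    exact Set.empty_ne_univ (by simpa using hsU)
  obtain ⟨x, rfl⟩ := hs.exists_eq_range hsne
  refine ⟨disjointed fun n => U (x n), fun n => .disjointed (fun n => (hUo _).measurableSet) n,
    disjoint_disjointed _, ?_, fun n => (measure_mono (disjointed_subset _ n)).trans_lt (hUε _)⟩
  rw [iUnion_disjointed, ← hsU, Set.biUnion_range]

lemma continuous_poissonMeasure_singleton (k : ℕ) :
    Continuous fun r : ℝ≥0 => poissonMeasure r {k} := by
  simp only [poissonMeasure_singleton]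
  exact ENNReal.continuous_ofReal.comp (by fun_prop)

lemma poissonMeasure_two_le (r : ℝ≥0) : poissonMeasure r {n | 2 ≤ n} ≤ (r : ℝ≥0∞) ^ 2 := by
  have hcompl : {n : ℕ | 2 ≤ n} = {0, 1}ᶜ := by ext n; simp; omega
  have h01 : (poissonMeasure r).real {0, 1} = Real.exp (-r) * (1 + r) := by
    rw [← Set.singleton_union, measureReal_union (by simp) (measurableSet_singleton _),
      poissonMeasure_real_singleton, poissonMeasure_real_singleton]
    simp; ring
  have hexp : (1 - (r : ℝ)) * (1 + r) ≤ Real.exp (-r) * (1 + r) :=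
    mul_le_mul_of_nonneg_right (Real.one_sub_le_exp_neg r) (by positivity)
  have hreal : (poissonMeasure r).real {n | 2 ≤ n} ≤ (r : ℝ) ^ 2 := by
    rw [hcompl, probReal_compl_eq_one_sub (Set.toFinite _).measurableSet, h01]
    linarith
  calc poissonMeasure r {n | 2 ≤ n} = ENNReal.ofReal _ := (ofReal_measureReal).symm
    _ ≤ ENNReal.ofReal ((r : ℝ) ^ 2) := ENNReal.ofReal_le_ofReal hreal
    _ = (r : ℝ≥0∞) ^ 2 := by rw [ENNReal.ofReal_pow r.coe_nonneg, ENNReal.ofReal_coe_nnreal]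

end Measures

section VennCells

variable {X ι : Type*}

/-- The cell of the Venn diagram of the family `U` consisting of the points which belong to `U i`
exactly for those `i` which satisfy `ε`. -/
def vennCell (U : ι → Set X) (ε : ι → Prop) : Set X := {x | ∀ i, x ∈ U i ↔ ε i}

lemma vennCell_eq_preimage (U : ι → Set X) (ε : ι → Prop) :
    vennCell U ε = (fun x i => x ∈ U i) ⁻¹' {ε} := by
  ext x; simp [vennCell, funext_iff]

lemma pairwise_disjoint_vennCell (U : ι → Set X) :
    Pairwise (Function.onFun Disjoint (vennCell U)) := by
  rw [funext (vennCell_eq_preimage U)]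
  exact pairwise_disjoint_fiber _

variable [MeasurableSpace X] {U : ι → Set X}

lemma measurableSet_vennCell [Countable ι] (hU : ∀ i, MeasurableSet (U i)) (ε : ι → Prop) :
    MeasurableSet (vennCell U ε) :=
  Measurable.setOf <| .forall fun i => .iff (measurableSet_setOfPred.1 (hU i)) measurable_const

open Classical in
lemma measure_inter_eq_sum_vennCell [Fintype ι] (hU : ∀ i, MeasurableSet (U i)) (K : Set X)
    (μ : Measure X) (i : ι) :
    μ (U i ∩ K) = ∑ ε : ι → Prop with ε i, μ (vennCell U ε ∩ K) := by
  have hcell := measurableSet_vennCell hU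
  simp only [← Measure.restrict_apply (hU i), ← Measure.restrict_apply (hcell _)]
  simp only [vennCell_eq_preimage] at hcell ⊢
  rw [sum_measure_preimage_singleton _ fun ε _ => hcell ε]
  congr 1
  ext x
  simp

end VennCells

section IndependentRestrictions

variable {X Ω : Type*} [MeasurableSpace X] [MeasurableSpace Ω] {P : Measure Ω} {ξ : Ω → Measure X}
  {E K L : Set X}

lemma indepFun_inter_of_disjoint (hξ : Measurable ξ)
    (hind : ∀ (n : ℕ) (A : Fin n → Set X), (∀ i, MeasurableSet (A i)) → (∀ i, A i ⊆ E) →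
      Pairwise (Function.onFun Disjoint A) → iIndepFun (fun i ω => ξ ω (A i)) P)
    (hK : MeasurableSet K) (hL : MeasurableSet L) (hKE : K ⊆ E) (hLE : L ⊆ E)
    (hKL : Disjoint K L) {ι κ : Type*} [Finite ι] [Finite κ] {U : ι → Set X} {V : κ → Set X}
    (hU : ∀ i, MeasurableSet (U i)) (hV : ∀ j, MeasurableSet (V j)) :
    IndepFun (fun ω i => ξ ω (U i ∩ K)) (fun ω j => ξ ω (V j ∩ L)) P := by
  classical
  have := Fintype.ofFinite ι
  have := Fintype.ofFinite κ
  let cell : (ι → Prop) ⊕ (κ → Prop) → Set X :=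
    Sum.elim (fun ε => vennCell U ε ∩ K) fun ε => vennCell V ε ∩ L
  have hcell : ∀ c, MeasurableSet (cell c) := Sum.rec
    (fun ε => (measurableSet_vennCell hU ε).inter hK)
    fun ε => (measurableSet_vennCell hV ε).inter hL
  have hcellE : ∀ c, cell c ⊆ E := Sum.rec
    (fun ε => Set.inter_subset_right.trans hKE) fun ε => Set.inter_subset_right.trans hLE
  have hdisj : Pairwise (Function.onFun Disjoint cell) := by
    rintro (ε | ε) (ε' | ε') hne
    · exact (pairwise_disjoint_vennCell U (by simpa using hne)).mono Set.inter_subset_left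
        Set.inter_subset_left
    · exact hKL.mono Set.inter_subset_right Set.inter_subset_right
    · exact hKL.symm.mono Set.inter_subset_right Set.inter_subset_right
    · exact (pairwise_disjoint_vennCell V (by simpa using hne)).mono Set.inter_subset_left
        Set.inter_subset_left
  have hcount : iIndepFun (fun c ω => ξ ω (cell c)) P := by
    let e := Fintype.equivFin ((ι → Prop) ⊕ (κ → Prop))
    simpa using (hind _ (fun i => cell (e.symm i)) (fun _ => hcell _) (fun _ => hcellE _)
      fun i j hij => hdisj (e.symm.injective.ne hij)).precomp e.injective
  let left : Finset ((ι → Prop) ⊕ (κ → Prop)) := Finset.univ.map .inl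
  let right : Finset ((ι → Prop) ⊕ (κ → Prop)) := Finset.univ.map .inr
  have hpair := hcount.indepFun_finset left right (Finset.disjoint_map_inl_map_inr _ _) fun c =>
    (Measure.measurable_coe (hcell c)).comp hξ
  let φ (y : left → ℝ≥0∞) (i : ι) := ∑ ε : ι → Prop with ε i, y ⟨.inl ε, by simp [left]⟩
  let ψ (y : right → ℝ≥0∞) (j : κ) := ∑ ε : κ → Prop with ε j, y ⟨.inr ε, by simp [right]⟩
  have hφ : Measurable φ := by fun_prop
  have hψ : Measurable ψ := by fun_prop
  convert hpair.comp hφ hψ using 3 with ω i ω j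
  · exact measure_inter_eq_sum_vennCell hU K (ξ ω) i
  · exact measure_inter_eq_sum_vennCell hV L (ξ ω) j

lemma indepFun_restrict_of_disjoint [IsProbabilityMeasure P] (hξ : Measurable ξ)
    (hind : ∀ (n : ℕ) (A : Fin n → Set X), (∀ i, MeasurableSet (A i)) → (∀ i, A i ⊆ E) →
      Pairwise (Function.onFun Disjoint A) → iIndepFun (fun i ω => ξ ω (A i)) P)
    (hK : MeasurableSet K) (hL : MeasurableSet L) (hKE : K ⊆ E) (hLE : L ⊆ E)
    (hKL : Disjoint K L) :
    IndepFun (fun ω => (ξ ω).restrict K) (fun ω => (ξ ω).restrict L) P := by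
  have hcount {K : Set X} (hK : MeasurableSet K) (A : {A : Set X // MeasurableSet A}) :
      Measurable fun ω => ξ ω (A ∩ K) :=
    (Measure.measurable_coe (A.2.inter hK)).comp hξ
  have hproc : IndepFun (fun ω (A : {A : Set X // MeasurableSet A}) => ξ ω (A ∩ K))
      (fun ω (A : {A : Set X // MeasurableSet A}) => ξ ω (A ∩ L)) P :=
    .process_indepFun_process (hcount hK) (hcount hL) fun I J =>
      indepFun_inter_of_disjoint hξ hind hK hL hKE hLE hKL (fun A => A.1.2) fun A => A.1.2
  have hle (K : Set X) : MeasurableSpace.comap (fun ω => (ξ ω).restrict K) inferInstance ≤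
      .comap (fun ω (A : {A : Set X // MeasurableSet A}) => ξ ω (A ∩ K)) inferInstance := by
    rw [← measurable_iff_comap_le]
    refine Measure.measurable_of_measurable_coe _ fun A hA => ?_
    simp only [Measure.restrict_apply hA]
    exact (measurable_pi_apply (X := fun _ : {A : Set X // MeasurableSet A} => ℝ≥0∞) ⟨A, hA⟩).comp
      (comap_measurable _)
  exact indep_of_indep_of_le_left (indep_of_indep_of_le_right hproc (hle L)) (hle K)

end IndependentRestrictions

section Convexity

variable {V : Type*} [NormedAddCommGroup V] [InnerProductSpace ℝ V]

/-- A countable family of closed half-spaces, rich enough to separate points from compact convex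
sets: the normals run through a dense sequence and the offsets are rational. -/
def ratHalfSpace [SeparableSpace V] (p : ℕ × ℚ) : Set V := {y | inner ℝ (denseSeq V p.1) y ≤ p.2}

lemma isClosed_ratHalfSpace [SeparableSpace V] (p : ℕ × ℚ) :
    IsClosed (ratHalfSpace p : Set V) :=
  isClosed_le (by fun_prop) continuous_const

lemma convex_ratHalfSpace [SeparableSpace V] (p : ℕ × ℚ) : Convex ℝ (ratHalfSpace p : Set V) :=
  convex_halfSpace_le (innerₛₗ ℝ _).isLinear _

lemma exists_subset_ratHalfSpace_notMem [CompleteSpace V] [SeparableSpace V] {s : Set V}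
    (hs : IsCompact s) (hc : Convex ℝ s) {x : V} (hx : x ∉ s) :
    ∃ p, s ⊆ ratHalfSpace p ∧ x ∉ ratHalfSpace p := by
  obtain ⟨f, a, b, hfs, hab, hfx⟩ :=
    geometric_hahn_banach_compact_closed hc hs (convex_singleton x) isClosed_singleton
      (Set.disjoint_singleton_right.2 hx)
  obtain ⟨q, haq, hqb⟩ := exists_rat_btwn hab
  set u := (InnerProductSpace.toDual ℝ V).symm f
  have hu (y : V) : inner ℝ u y = f y := InnerProductSpace.toDual_symm_apply
  have hlt : ∀ᶠ v in nhds u, ∀ y ∈ s, inner ℝ v y < q :=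
    hs.eventually_forall_of_forall_eventually fun y hy =>
      (continuous_inner.tendsto (u, y)).eventually_lt_const (by rw [hu]; linarith [hfs y hy])
  have hgt : ∀ᶠ v in nhds u, q < inner ℝ v x :=
    ((continuous_id.inner continuous_const).tendsto u).eventually_const_lt
      (by rw [id, hu]; linarith [hfx x rfl])
  obtain ⟨n, hn, hnx⟩ := (denseRange_denseSeq V).mem_nhds (hlt.and hgt)
  exact ⟨(n, q), fun y hy => (hn y hy).le, not_le.2 hnx⟩

lemma convexHull_extremePoints_convexHull {s : Set V} (hs : s.Finite) :
    convexHull ℝ ((convexHull ℝ s).extremePoints ℝ) = convexHull ℝ s := by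
  have hext : ((convexHull ℝ s).extremePoints ℝ).Finite :=
    hs.subset extremePoints_convexHull_subset
  rw [← (hext.isCompact_convexHull ℝ).isClosed.closure_eq]
  exact closure_convexHull_extremePoints (hs.isCompact_convexHull ℝ) (convex_convexHull ℝ s)

lemma mem_extremePoints_of_notMem_convexHull {s : Set V} (hs : s.Finite) {x : V} (hx : x ∈ s)
    (h : x ∉ convexHull ℝ (s \ {x})) : x ∈ (convexHull ℝ s).extremePoints ℝ := by
  by_contra hne
  have hsub : (convexHull ℝ s).extremePoints ℝ ⊆ s \ {x} := fun y hy =>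
    ⟨extremePoints_convexHull_subset hy, by rintro rfl; exact hne hy⟩
  refine h (convexHull_mono hsub ?_)
  rw [convexHull_extremePoints_convexHull hs]
  exact subset_convexHull ℝ s hx

lemma extremePoints_convexHull_range {ι : Type*} [Finite ι] {x : ι → V}
    (hx : ConvexIndependent ℝ x) :
    (convexHull ℝ (Set.range x)).extremePoints ℝ = Set.range x := by
  refine extremePoints_convexHull_subset.antisymm ?_
  rintro _ ⟨i, rfl⟩
  refine mem_extremePoints_of_notMem_convexHull (Set.finite_range x) ⟨i, rfl⟩ ?_
  have := convexIndependent_iff_notMem_convexHull_sdiff.1 hx i Set.univ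
  rwa [Set.image_sdiff hx.injective, Set.image_univ, Set.image_singleton] at this

end Convexity

/-- A polytope, given as the convex hull of a finite, possibly empty, set. -/
@[ext]
structure Polytope (V : Type*) [AddCommGroup V] [Module ℝ V] where
  carrier : Set V
  exists_finite : ∃ t : Set V, t.Finite ∧ convexHull ℝ t = carrier

namespace Polytope

section Basic

variable {V : Type*} [AddCommGroup V] [Module ℝ V]

/-- The polytope spanned by a finite family of points. -/
def span {ι : Type*} [Finite ι] (x : ι → V) : Polytope V :=
  ⟨convexHull ℝ (Set.range x), _, Set.finite_range x, rfl⟩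

protected lemma convex (s : Polytope V) : Convex ℝ s.carrier := by
  obtain ⟨t, -, ht⟩ := s.exists_finite
  exact ht ▸ convex_convexHull ℝ t

lemma finite_extremePoints (s : Polytope V) : (s.carrier.extremePoints ℝ).Finite := by
  obtain ⟨t, ht, hs⟩ := s.exists_finite
  exact hs ▸ ht.subset extremePoints_convexHull_subset

/-- The σ-algebra generated by the events `s ⊆ B`, where `B` is closed and convex. -/
instance [TopologicalSpace V] : MeasurableSpace (Polytope V) :=
  .generateFrom {S | ∃ B : Set V, Convex ℝ B ∧ IsClosed B ∧ S = {s | s.carrier ⊆ B}}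

lemma measurableSet_subset [TopologicalSpace V] {B : Set V} (hB : Convex ℝ B) (hB' : IsClosed B) :
    MeasurableSet {s : Polytope V | s.carrier ⊆ B} :=
  .basic _ ⟨B, hB, hB', rfl⟩

lemma measurable_span [TopologicalSpace V] [MeasurableSpace V] [OpensMeasurableSpace V]
    {ι : Type*} [Finite ι] : Measurable (span : (ι → V) → Polytope V) := by
  refine measurable_generateFrom ?_
  rintro _ ⟨B, hB, hB', rfl⟩
  have : span ⁻¹' {s : Polytope V | s.carrier ⊆ B} = ⋂ i : ι, (fun x => x i) ⁻¹' B := by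
    ext x
    simp [span, hB.convexHull_subset_iff, Set.range_subset_iff]
  rw [this]
  exact .iInter fun i => measurable_pi_apply i hB'.measurableSet

end Basic

variable {V : Type*} [NormedAddCommGroup V] [InnerProductSpace ℝ V]

protected lemma isCompact (s : Polytope V) : IsCompact s.carrier := by
  obtain ⟨t, ht, hs⟩ := s.exists_finite
  exact hs ▸ ht.isCompact_convexHull ℝ

lemma exists_convexIndependent_span_eq (s : Polytope V) :
    ∃ (n : ℕ) (x : ℕ → V), ConvexIndependent ℝ (fun i : Fin n => x i) ∧
      span (fun i : Fin n => x i) = s := by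
  have := s.finite_extremePoints.to_subtype
  obtain ⟨n, ⟨e⟩⟩ := Finite.exists_equiv_fin (s.carrier.extremePoints ℝ)
  let x (i : ℕ) : V := if h : i < n then e.symm ⟨i, h⟩ else 0
  have hx : (fun i : Fin n => x i) = fun i => (e.symm i : V) := by ext i; simp [x]
  refine ⟨n, x, ?_, Polytope.ext ?_⟩
  · rw [hx]
    exact s.convex.convexIndependent_extremePoints.comp_embedding e.symm.toEmbedding
  · obtain ⟨t, ht, hs⟩ := s.exists_finite
    change convexHull ℝ (Set.range _) = _
    rw [hx, Set.range_comp' Subtype.val e.symm, e.symm.surjective.range_eq, Set.image_univ,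
      Subtype.range_coe, ← hs, convexHull_extremePoints_convexHull ht]

variable [SeparableSpace V]

lemma measurableSet_subset_ratHalfSpace (p : ℕ × ℚ) :
    MeasurableSet {s : Polytope V | s.carrier ⊆ ratHalfSpace p} :=
  measurableSet_subset (convex_ratHalfSpace p) (isClosed_ratHalfSpace p)

variable [CompleteSpace V]

lemma subset_carrier_iff (s : Polytope V) {W : Set V} :
    W ⊆ s.carrier ↔ ∀ p, s.carrier ⊆ ratHalfSpace p → W ⊆ ratHalfSpace p := by
  refine ⟨fun h p => h.trans, fun h x hx => ?_⟩
  by_contra hxs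
  obtain ⟨p, hp, hxp⟩ := exists_subset_ratHalfSpace_notMem s.isCompact s.convex hxs
  exact hxp (h p hp hx)

lemma measurableSet_superset (W : Set V) : MeasurableSet {s : Polytope V | W ⊆ s.carrier} := by
  simp only [subset_carrier_iff]
  exact Measurable.setOf <| .forall fun p =>
    .imp (measurableSet_setOfPred.1 (measurableSet_subset_ratHalfSpace p)) measurable_const

instance : MeasurableSpace.CountablySeparated (Polytope V) where
  countably_separated := by
    refine ⟨Set.range fun p => {s : Polytope V | s.carrier ⊆ ratHalfSpace p},
      Set.countable_range _, ?_, fun s _ t _ h => ?_⟩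
    · rintro _ ⟨p, rfl⟩
      exact measurableSet_subset_ratHalfSpace p
    · have h (p) : s.carrier ⊆ ratHalfSpace p ↔ t.carrier ⊆ ratHalfSpace p := h _ ⟨p, rfl⟩
      exact Polytope.ext (((subset_carrier_iff t).2 fun p => (h p).2).antisymm
        ((subset_carrier_iff s).2 fun p => (h p).1))

variable [MeasurableSpace V] [BorelSpace V]

lemma measurableSet_mem :
    MeasurableSet {p : Polytope V × V | p.2 ∈ p.1.carrier} := by
  simp only [← Set.singleton_subset_iff (a := (_ : V)), subset_carrier_iff]
  refine Measurable.setOf <| .forall fun p => .imp ?_ ?_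
  · exact measurableSet_setOfPred.1 (measurable_fst (measurableSet_subset_ratHalfSpace p))
  · simp only [Set.singleton_subset_iff]
    exact measurableSet_setOfPred.1 (measurable_snd (isClosed_ratHalfSpace p).measurableSet)

lemma measurableSet_convexIndependent [SecondCountableTopology V] {ι : Type*} [Finite ι] :
    MeasurableSet {x : ι → V | ConvexIndependent ℝ x} := by
  simp only [convexIndependent_iff_notMem_convexHull_sdiff, Set.image_eq_range]
  refine Measurable.setOf <| .forall fun i => .forall fun t => .not <| measurableSet_setOfPred.1 ?_
  exact measurableSet_mem.preimage (f := fun x : ι → V => (span fun j : ↥(t \ {i}) => x j, x i))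
    ((measurable_span.comp (by fun_prop)).prodMk (by fun_prop))

/-- The counting measure on the set of vertices of a polytope. -/
def vertexMeasure (s : Polytope V) : Measure V :=
  Measure.count.restrict (s.carrier.extremePoints ℝ)

lemma vertexMeasure_span {ι : Type*} [Fintype ι] {x : ι → V} (hx : ConvexIndependent ℝ x) :
    (span x).vertexMeasure = ∑ i, Measure.dirac (x i) := by
  change Measure.count.restrict ((convexHull ℝ (Set.range x)).extremePoints ℝ) = _
  rw [extremePoints_convexHull_range hx, ← Set.iUnion_singleton_eq_range, Measure.restrict_iUnion
    (fun i j hij => Set.disjoint_singleton.2 (hx.injective.ne hij)) fun i => .singleton _,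
    Measure.sum_fintype]
  simp only [Measure.restrict_singleton, Measure.count_singleton, one_smul]

lemma measurable_vertexMeasure [SecondCountableTopology V] :
    Measurable (vertexMeasure : Polytope V → Measure V) := by
  let Z := {p : ℕ × (ℕ → V) | ConvexIndependent ℝ fun i : Fin p.1 => p.2 i}
  have hinit (n : ℕ) : Measurable fun (y : ℕ → V) (i : Fin n) => y i := by fun_prop
  have hspan : Measurable fun p : ℕ × (ℕ → V) => span fun i : Fin p.1 => p.2 i :=
    measurable_from_prod_countable_right fun n => measurable_span.comp (hinit n)
  have hsum (n : ℕ) : Measurable fun y : ℕ → V => ∑ i : Fin n, Measure.dirac (y i) :=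
    Finset.measurable_fun_sum Finset.univ fun i _ =>
      Measure.measurable_dirac.fun_comp (measurable_pi_apply (i : ℕ))
  have hdirac : Measurable fun p : ℕ × (ℕ → V) => ∑ i : Fin p.1, Measure.dirac (p.2 i) :=
    measurable_from_prod_countable_right hsum
  have hZ : MeasurableSet Z := Measurable.setOf <|
    measurable_from_prod_countable_right fun n => measurableSet_setOfPred.1 <|
      measurableSet_convexIndependent.preimage (hinit n)
  have : StandardBorelSpace Z := hZ.standardBorel
  let π (z : Z) : Polytope V := span fun i : Fin z.1.1 => z.1.2 i
  have hπ : Function.Surjective π := fun s => by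
    obtain ⟨n, x, hx, hs⟩ := s.exists_convexIndependent_span_eq
    exact ⟨⟨(n, x), hx⟩, hs⟩
  rw [← (hspan.comp measurable_subtype_coe).measurable_comp_iff_of_surjective hπ]
  have hπ' : vertexMeasure ∘ π = fun z : Z => ∑ i : Fin z.1.1, Measure.dirac (z.1.2 i) :=
    funext fun z => vertexMeasure_span z.2
  change Measurable (vertexMeasure ∘ π)
  rw [hπ']
  exact hdirac.comp measurable_subtype_coe

end Polytope

section OuterApproximation

variable {X : Type*} [TopologicalSpace X] [SecondCountableTopology X]

variable (X) in
/-- An enumeration of a countable basis of the topology of `X`. -/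
def basisSeq : ℕ → Set X := (exists_seq_basis X).choose

lemma isTopologicalBasis_basisSeq : IsTopologicalBasis (Set.range (basisSeq X)) :=
  (exists_seq_basis X).choose_spec

lemma isOpen_basisSeq (i : ℕ) : IsOpen (basisSeq X i) :=
  isTopologicalBasis_basisSeq.isOpen ⟨i, rfl⟩

/-- The union of the sets of the basis `basisSeq X` with index in `I`. -/
def basisUnion (I : Finset ℕ) : Set X := ⋃ i ∈ I, basisSeq X i

lemma isOpen_basisUnion (I : Finset ℕ) : IsOpen (basisUnion I : Set X) :=
  isOpen_biUnion fun i _ => isOpen_basisSeq i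

open Classical in
/-- The indices below `n` of the sets of the basis `basisSeq X` which do not meet `K`. The sets
`basisUnion (missed K n)` are finite-range approximations of `Kᶜ` from inside. -/
def missed (K : Set X) (n : ℕ) : Finset ℕ := {i ∈ Finset.range n | Disjoint (basisSeq X i) K}

lemma mem_missed {K : Set X} {n i : ℕ} :
    i ∈ missed K n ↔ i < n ∧ Disjoint (basisSeq X i) K := by
  simp [missed]

lemma basisUnion_missed_subset (K : Set X) (n : ℕ) : basisUnion (missed K n) ⊆ Kᶜ :=
  Set.iUnion₂_subset fun _ hi => (mem_missed.1 hi).2.subset_compl_right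

lemma monotone_basisUnion_missed (K : Set X) :
    Monotone fun n => (basisUnion (missed K n) : Set X) :=
  fun n _ hnk => Set.biUnion_subset_biUnion_left fun i hi =>
    have hi : i ∈ missed K n := hi
    mem_missed.2 ⟨(mem_missed.1 hi).1.trans_le hnk, (mem_missed.1 hi).2⟩

lemma iUnion_basisUnion_missed {K : Set X} (hK : IsClosed K) :
    ⋃ n, basisUnion (missed K n) = Kᶜ := by
  refine (Set.iUnion_subset (basisUnion_missed_subset K)).antisymm fun x hx => ?_
  obtain ⟨_, ⟨i, rfl⟩, hxi, hi⟩ :=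
    isTopologicalBasis_basisSeq.exists_subset_of_mem_open hx hK.isOpen_compl
  exact Set.mem_iUnion.2 ⟨i + 1, Set.mem_biUnion
    (mem_missed.2 ⟨i.lt_succ_self, Set.disjoint_right.2 fun y hy hyi => hi hyi hy⟩) hxi⟩

lemma eventually_mem_basisUnion_missed {K : Set X} (hK : IsClosed K) {s : Set X} (hs : s.Finite) :
    ∀ᶠ n in Filter.atTop, ∀ x ∈ s, x ∈ basisUnion (missed K n) ↔ x ∉ K := by
  refine (Filter.eventually_all_finite hs).2 fun x _ => ?_
  by_cases hx : x ∈ K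
  · exact .of_forall fun n => iff_of_false (fun h => basisUnion_missed_subset K n h hx) (· hx)
  · obtain ⟨n, hn⟩ := Set.mem_iUnion.1 ((iUnion_basisUnion_missed hK).ge hx)
    filter_upwards [Filter.eventually_ge_atTop n] with k hk
    exact iff_of_true (monotone_basisUnion_missed K hk hn) hx

/-- The compact set obtained from `E` by removing the sets of the basis with index in `I`. -/
def removeBasis (E : Compacts X) (I : Finset ℕ) : Compacts X :=
  ⟨E \ basisUnion I, E.isCompact.diff (isOpen_basisUnion I)⟩

lemma removeBasis_le (E : Compacts X) (I : Finset ℕ) : removeBasis E I ≤ E := Set.sdiff_subset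

lemma le_removeBasis_iff {E K : Compacts X} (hKE : K ≤ E) (I : Finset ℕ) :
    K ≤ removeBasis E I ↔ ∀ i ∈ I, Disjoint (basisSeq X i) K := by
  change (K : Set X) ⊆ E \ basisUnion I ↔ _
  rw [Set.subset_sdiff, and_iff_right (show (K : Set X) ⊆ E from hKE), disjoint_comm]
  simp only [basisUnion, Set.disjoint_iUnion_left]

section Measurability

variable {α : Type*} [MeasurableSpace α]

lemma measurableSet_missed_eq {𝒦 : α → Set X}
    (h𝒦 : ∀ i, MeasurableSet {a | Disjoint (basisSeq X i) (𝒦 a)}) (n : ℕ) (I : Finset ℕ) :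
    MeasurableSet {a | missed (𝒦 a) n = I} := by
  simp only [Finset.ext_iff, mem_missed]
  exact Measurable.setOf <| .forall fun i =>
    (measurable_const.and (measurableSet_setOfPred.1 (h𝒦 i))).iff measurable_const

lemma measurable_apply_missed {β : Type*} [MeasurableSpace β] {𝒦 : α → Set X}
    (h𝒦 : ∀ i, MeasurableSet {a | Disjoint (basisSeq X i) (𝒦 a)}) (n : ℕ)
    {f : Finset ℕ → α → β} (hf : ∀ I, Measurable (f I)) :
    Measurable fun a => f (missed (𝒦 a) n) a := by
  let _ : MeasurableSpace (Finset ℕ) := ⊤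
  have hmissed : Measurable fun a => missed (𝒦 a) n :=
    measurable_to_countable' (measurableSet_missed_eq h𝒦 n)
  exact (measurable_from_prod_countable_right (f := fun p : Finset ℕ × α => f p.1 p.2) hf).comp
    (hmissed.prodMk measurable_id)

lemma measurableSet_eventually_mem_missed {β : Type*} [MeasurableSpace β] {𝒦 : α → Set X}
    (h𝒦 : ∀ i, MeasurableSet {a | Disjoint (basisSeq X i) (𝒦 a)}) {f : α → β} (hf : Measurable f)
    {S : ℕ → Finset ℕ → Set β} (hS : ∀ n I, MeasurableSet (S n I)) :
    MeasurableSet {a | ∀ᶠ n in Filter.atTop, f a ∈ S n (missed (𝒦 a) n)} := by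
  simp only [Filter.eventually_atTop]
  exact Measurable.setOf <| .exists fun N => .forall fun n => .imp measurable_const <|
    measurable_apply_missed h𝒦 n fun I => measurableSet_setOfPred.1 (hf (hS n I))

lemma measurableSet_notMem_of_isClosed [MeasurableSpace X] [OpensMeasurableSpace X]
    {𝒦 : α → Set X} (h𝒦 : ∀ i, MeasurableSet {a | Disjoint (basisSeq X i) (𝒦 a)})
    (hcl : ∀ a, IsClosed (𝒦 a)) : MeasurableSet {p : α × X | p.2 ∉ 𝒦 p.1} := by
  have : {p : α × X | p.2 ∉ 𝒦 p.1} =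
      ⋃ i, {a | Disjoint (basisSeq X i) (𝒦 a)} ×ˢ basisSeq X i := by
    ext ⟨a, x⟩
    refine ⟨fun hx => ?_, fun hx => ?_⟩
    · obtain ⟨_, ⟨i, rfl⟩, hxi, hi⟩ := isTopologicalBasis_basisSeq.exists_subset_of_mem_open
        (show x ∈ (𝒦 a)ᶜ from hx) (hcl a).isOpen_compl
      exact Set.mem_iUnion.2 ⟨i, Set.disjoint_right.2 fun y hy hyi => hi hyi hy, hxi⟩
    · obtain ⟨i, hi, hxi⟩ := Set.mem_iUnion.1 hx
      exact Set.disjoint_left.1 hi hxi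
  rw [this]
  exact .iUnion fun i => (h𝒦 i).prod (isOpen_basisSeq i).measurableSet

lemma measurable_measure_diff [MeasurableSpace X] [OpensMeasurableSpace X] {𝒦 : α → Set X}
    (h𝒦 : ∀ i, MeasurableSet {a | Disjoint (basisSeq X i) (𝒦 a)}) (hcl : ∀ a, IsClosed (𝒦 a))
    {κ : α → Measure X} [∀ a, IsFiniteMeasure (κ a)] (hκ : Measurable κ) {A : Set X}
    (hA : MeasurableSet A) : Measurable fun a => κ a (A \ 𝒦 a) :=
  measurable_measure_prodMk_preimage hκ
    ((hA.preimage measurable_snd).inter (measurableSet_notMem_of_isClosed h𝒦 hcl))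

lemma measurableSet_compacts_subset [T2Space X] {E : Compacts X} {𝒦 : α → Compacts X}
    (hE : ∀ a, 𝒦 a ≤ E) (h𝒦 : ∀ i, MeasurableSet {a | Disjoint (basisSeq X i) (𝒦 a)})
    {U : Set X} (hU : IsOpen U) : MeasurableSet {a | (𝒦 a : Set X) ⊆ U} := by
  have : {a | (𝒦 a : Set X) ⊆ U} =
      ⋃ (n : ℕ) (I : Finset ℕ) (_ : (E : Set X) \ U ⊆ basisUnion I),
        {a | missed (𝒦 a : Set X) n = I} := by
    ext a
    simp only [Set.mem_iUnion, Set.mem_ofPred_eq]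
    refine ⟨fun hKU => ?_, ?_⟩
    · have hcover : (E : Set X) \ U ⊆ ⋃ n, basisUnion (missed (𝒦 a : Set X) n) := by
        rw [iUnion_basisUnion_missed (𝒦 a).isCompact.isClosed]
        exact fun x hx hxK => hx.2 (hKU hxK)
      obtain ⟨n, hn⟩ := (E.isCompact.diff hU).elim_directed_cover _
        (fun n => isOpen_basisUnion _) hcover (monotone_basisUnion_missed _).directed_le
      exact ⟨n, _, hn, rfl⟩
    · rintro ⟨n, _, hn, rfl⟩ x hx
      by_contra hxU
      exact basisUnion_missed_subset _ n (hn ⟨hE a hx, hxU⟩) hx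
  rw [this]
  exact .iUnion fun n => .iUnion fun I => .iUnion fun _ => measurableSet_missed_eq h𝒦 n I

lemma measurableSet_inter_nonempty {𝒦 : α → Set X}
    (h𝒦 : ∀ i, MeasurableSet {a | Disjoint (basisSeq X i) (𝒦 a)}) {U : Set X} (hU : IsOpen U) :
    MeasurableSet {a | (𝒦 a ∩ U).Nonempty} := by
  have : {a | (𝒦 a ∩ U).Nonempty} =
      ⋃ (i : ℕ) (_ : basisSeq X i ⊆ U), {a | Disjoint (basisSeq X i) (𝒦 a)}ᶜ := by
    ext a
    simp only [Set.mem_ofPred_eq, Set.mem_iUnion, Set.mem_compl_iff, Set.not_disjoint_iff]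
    refine ⟨fun ⟨x, hxK, hxU⟩ => ?_, fun ⟨_, hi, x, hxi, hxK⟩ => ⟨x, hxK, hi hxi⟩⟩
    obtain ⟨_, ⟨i, rfl⟩, hxi, hi⟩ := isTopologicalBasis_basisSeq.exists_subset_of_mem_open hxU hU
    exact ⟨i, hi, x, hxi, hxK⟩
  rw [this]
  exact .iUnion fun i => .iUnion fun _ => (h𝒦 i).compl

lemma measurable_compacts [T2Space X] {E : Compacts X} {𝒦 : α → Compacts X} (hE : ∀ a, 𝒦 a ≤ E)
    (h𝒦 : ∀ i, MeasurableSet {a | Disjoint (basisSeq X i) (𝒦 a)}) :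
    Measurable[_, borel _] 𝒦 := by
  rw [borel_eq_generateFrom_of_subbasis
    (induced_generateFrom_eq : (Compacts.topology : TopologicalSpace (Compacts X)) = _)]
  refine measurable_generateFrom ?_
  rintro _ ⟨_, ⟨U, hU, rfl⟩ | ⟨U, hU, rfl⟩, rfl⟩
  · exact measurableSet_compacts_subset hE h𝒦 hU
  · exact measurableSet_inter_nonempty h𝒦 hU

end Measurability

end OuterApproximation

open Filter Topology

variable {d : ℕ} {E : Compacts (EuclideanSpace ℝ (Fin d))}

local notation "ℝᵈ" => EuclideanSpace ℝ (Fin d)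

section PointMeasures

/-- The set of points of a point measure. -/
def atoms (m : PointMeasure E) : Set ℝᵈ := {x | m.1 {x} ≠ 0}

instance (m : PointMeasure E) : IsFiniteMeasure m.1 :=
  ⟨by obtain ⟨n, hn⟩ := m.2.2 Set.univ .univ; simp [hn]⟩

lemma one_le_measure_of_ne_zero (m : PointMeasure E) {A : Set ℝᵈ} (hA : MeasurableSet A)
    (h : m.1 A ≠ 0) : 1 ≤ m.1 A := by
  obtain ⟨n, hn⟩ := m.2.2 A hA
  rw [hn] at h ⊢
  exact Nat.one_le_cast.2 (Nat.one_le_iff_ne_zero.2 (Nat.cast_ne_zero.1 h))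

lemma finite_atoms (m : PointMeasure E) : (atoms m).Finite := by
  by_contra h
  exact measure_ne_top m.1 _ (Set.Infinite.meas_eq_top h
    ⟨1, one_ne_zero, fun x hx => one_le_measure_of_ne_zero m (measurableSet_singleton x) hx⟩)

lemma measure_compl_atoms (m : PointMeasure E) : m.1 (atoms m)ᶜ = 0 := by
  refine measure_null_of_locally_null _ fun x hx => ?_
  have hx : m.1 {x} < 1 := by rw [not_not.1 hx]; exact one_pos
  obtain ⟨U, hU, hUo, hU1⟩ := Set.exists_isOpen_lt_of_lt _ _ hx
  refine ⟨U, mem_nhdsWithin_of_mem_nhds (hUo.mem_nhds (hU rfl)), ?_⟩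
  by_contra h
  exact absurd (one_le_measure_of_ne_zero m hUo.measurableSet h) (not_le.2 hU1)

lemma measure_eq_zero_iff_disjoint_atoms (m : PointMeasure E) (A : Set ℝᵈ) :
    m.1 A = 0 ↔ Disjoint A (atoms m) := by
  refine ⟨fun h => Set.disjoint_left.2 fun x hx hxa => hxa ?_, fun h => ?_⟩
  · exact measure_mono_null (Set.singleton_subset_iff.2 hx) h
  · exact measure_mono_null (Set.subset_compl_iff_disjoint_right.2 h) (measure_compl_atoms m)

lemma measure_congr_atoms (m : PointMeasure E) {A B : Set ℝᵈ}
    (h : ∀ x ∈ atoms m, x ∈ A ↔ x ∈ B) : m.1 A = m.1 B := by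
  have hae : ∀ᵐ x ∂m.1, x ∈ atoms m := measure_compl_atoms m
  refine measure_congr ?_
  filter_upwards [hae] with x hx
  exact propext (h x hx)

lemma atoms_subset (m : PointMeasure E) : atoms m ⊆ E :=
  Set.disjoint_compl_left_iff_subset.1 ((measure_eq_zero_iff_disjoint_atoms m _).1 m.2.1)

lemma atoms_subset_interior {m : PointMeasure E} (hm : m.1 (frontier (E : Set ℝᵈ)) = 0) :
    atoms m ⊆ interior E := fun x hx => by
  by_contra hxi
  refine Set.disjoint_left.1 ((measure_eq_zero_iff_disjoint_atoms m _).1 hm) ?_ hx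
  rw [E.isCompact.isClosed.frontier_eq]
  exact ⟨atoms_subset m hx, hxi⟩

lemma measurable_eval {A : Set ℝᵈ} (hA : MeasurableSet A) :
    Measurable fun m : PointMeasure E => m.1 A :=
  (Measure.measurable_coe hA).comp measurable_subtype_coe

/-- The restriction of a point measure to a set. As the measure is carried by finitely many atoms,
no measurability of the set is required. -/
def restr (m : PointMeasure E) (K : Set ℝᵈ) : PointMeasure E :=
  ⟨m.1.restrict K, Measure.restrict_le_self.absolutelyContinuous m.2.1, fun A hA => by
    rw [Measure.restrict_apply hA, measure_congr_atoms m (B := A ∩ K ∩ atoms m) (by simp_all)]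
    exact m.2.2 _ ((finite_atoms m).subset Set.inter_subset_right).measurableSet⟩

lemma measure_restr (m : PointMeasure E) (K : Set ℝᵈ) {A : Set ℝᵈ} (hA : MeasurableSet A) :
    (restr m K).1 A = m.1 (A ∩ K) :=
  Measure.restrict_apply hA

lemma atoms_restr (m : PointMeasure E) (K : Set ℝᵈ) : atoms (restr m K) = atoms m ∩ K := by
  ext x
  change (restr m K).1 {x} ≠ 0 ↔ m.1 {x} ≠ 0 ∧ x ∈ K
  rw [measure_restr m K (measurableSet_singleton x)]
  by_cases hx : x ∈ K <;> simp [hx]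

lemma measurable_restr {K : Set ℝᵈ} (hK : MeasurableSet K) :
    Measurable fun m : PointMeasure E => restr m K :=
  Measurable.subtype_mk <| Measure.measurable_of_measurable_coe _ fun A hA => by
    simp only [Measure.restrict_apply hA]
    exact measurable_eval (hA.inter hK)

lemma restr_congr {m : PointMeasure E} {K L : Set ℝᵈ} (h : ∀ x ∈ atoms m, x ∈ K ↔ x ∈ L) :
    restr m K = restr m L :=
  Subtype.ext <| Measure.ext fun A hA => by
    rw [measure_restr m K hA, measure_restr m L hA]
    exact measure_congr_atoms m fun x hx => and_congr_right fun _ => h x hx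

lemma restr_eq_self {m : PointMeasure E} {K : Set ℝᵈ} (h : atoms m ⊆ K) : restr m K = m :=
  Subtype.ext <| Measure.restrict_eq_self_of_ae_mem <|
    measure_mono_null (Set.compl_subset_compl.2 h) (measure_compl_atoms m)

end PointMeasures

section Hull

lemma hull_eq_convexHull_atoms (m : PointMeasure E) : hull m = convexHull ℝ (atoms m) := rfl

lemma atoms_subset_hull (m : PointMeasure E) : atoms m ⊆ hull m := subset_convexHull ℝ _

lemma hull_subset (hE : Convex ℝ (E : Set ℝᵈ)) (m : PointMeasure E) : hull m ⊆ E :=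
  convexHull_min (atoms_subset m) hE

lemma hull_subset_iff_measure_compl_eq_zero (m : PointMeasure E) {B : Set ℝᵈ} (hB : Convex ℝ B) :
    hull m ⊆ B ↔ m.1 Bᶜ = 0 := by
  rw [measure_eq_zero_iff_disjoint_atoms, hull_eq_convexHull_atoms, hB.convexHull_subset_iff,
    Set.disjoint_compl_left_iff_subset]

/-- The convex hull of the points of a point measure, as a polytope. -/
def hullPolytope (m : PointMeasure E) : Polytope ℝᵈ := ⟨hull m, atoms m, finite_atoms m, rfl⟩

lemma measurable_hullPolytope : Measurable (hullPolytope : PointMeasure E → Polytope ℝᵈ) := by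
  refine measurable_generateFrom ?_
  rintro _ ⟨B, hB, hB', rfl⟩
  change MeasurableSet {m : PointMeasure E | hull m ⊆ B}
  simp only [hull_subset_iff_measure_compl_eq_zero _ hB]
  exact measurable_eval hB'.measurableSet.compl (measurableSet_singleton 0)

lemma isClosed_hull (m : PointMeasure E) : IsClosed (hull m) :=
  (hullPolytope m).isCompact.isClosed

lemma convex_hull (m : PointMeasure E) : Convex ℝ (hull m) := (hullPolytope m).convex

lemma measurableSet_mem_hull : MeasurableSet {p : PointMeasure E × ℝᵈ | p.2 ∈ hull p.1} :=
  Polytope.measurableSet_mem.preimage (f := fun p : PointMeasure E × ℝᵈ => (hullPolytope p.1, p.2))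
    ((measurable_hullPolytope.comp measurable_fst).prodMk measurable_snd)

lemma extremePoints_hull_subset_atoms (m : PointMeasure E) :
    (hull m).extremePoints ℝ ⊆ atoms m :=
  extremePoints_convexHull_subset

lemma extremePoints_hull_subset_frontier (hd : 0 < d) (m : PointMeasure E) :
    (hull m).extremePoints ℝ ⊆ frontier (hull m) := fun x hx => by
  have : Nonempty (Fin d) := ⟨⟨0, hd⟩⟩
  rw [(isClosed_hull m).frontier_eq]
  exact ⟨hx.1, fun h => Set.disjoint_left.1 (disjoint_interior_extremePoints (hull m)) h hx⟩

lemma hull_restr_subset (m : PointMeasure E) (K : Set ℝᵈ) : hull (restr m K) ⊆ hull m := by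
  rw [hull_eq_convexHull_atoms, atoms_restr]
  exact convexHull_mono Set.inter_subset_left

lemma hull_restr_eq {m : PointMeasure E} {K : Set ℝᵈ}
    (h : (hull m).extremePoints ℝ ⊆ K) : hull (restr m K) = hull m := by
  refine (hull_restr_subset m K).antisymm ?_
  rw [hull_eq_convexHull_atoms, ← convexHull_extremePoints_convexHull (finite_atoms m),
    hull_eq_convexHull_atoms, atoms_restr]
  exact convexHull_mono fun x hx => ⟨extremePoints_hull_subset_atoms m hx, h hx⟩

end Hull

section ClosedCompl

lemma closedCompl_le_iff (m : PointMeasure E) (K : Compacts ℝᵈ) :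
    closedCompl m ≤ K ↔ (E : Set ℝᵈ) \ K ⊆ hull m := by
  change closure _ ⊆ (K : Set ℝᵈ) ↔ _
  rw [K.isCompact.isClosed.closure_subset_iff, Set.sdiff_subset_comm]

lemma closedCompl_le (m : PointMeasure E) : closedCompl m ≤ E :=
  (closedCompl_le_iff m E).2 (by simp)

lemma measurableSet_closedCompl_le (K : Compacts ℝᵈ) :
    MeasurableSet {m : PointMeasure E | closedCompl m ≤ K} := by
  simp only [closedCompl_le_iff]
  exact measurable_hullPolytope (Polytope.measurableSet_superset ((E : Set ℝᵈ) \ K))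

lemma disjoint_closedCompl_iff (m : PointMeasure E) {U : Set ℝᵈ} (hU : IsOpen U) :
    Disjoint U (closedCompl m) ↔ U ∩ E ⊆ hull m := by
  change Disjoint U (closure (E \ hull m)) ↔ _
  rw [← Set.subset_compl_iff_disjoint_right, ← interior_compl, hU.subset_interior_iff,
    Set.compl_sdiff, Set.subset_union_compl_iff_inter_subset]

lemma measurableSet_disjoint_closedCompl {U : Set ℝᵈ} (hU : IsOpen U) :
    MeasurableSet {m : PointMeasure E | Disjoint U (closedCompl m)} := by
  simp only [disjoint_closedCompl_iff _ hU]
  exact measurable_hullPolytope (Polytope.measurableSet_superset (U ∩ E))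

lemma interior_hull_eq_diff_closedCompl (hE : Convex ℝ (E : Set ℝᵈ)) (m : PointMeasure E) :
    interior (hull m) = interior E \ closedCompl m := by
  change _ = interior (E : Set ℝᵈ) \ closure (E \ hull m)
  rw [Set.sdiff_eq, ← interior_compl, ← interior_inter, Set.compl_sdiff,
    Set.inter_union_distrib_left]
  simp [Set.inter_eq_right.2 (hull_subset hE m)]

lemma measurableSet_mem_interior_hull (hE : Convex ℝ (E : Set ℝᵈ)) :
    MeasurableSet {p : PointMeasure E × ℝᵈ | p.2 ∈ interior (hull p.1)} := by
  simp only [interior_hull_eq_diff_closedCompl hE]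
  exact (measurable_snd isOpen_interior.measurableSet).inter <| measurableSet_notMem_of_isClosed
    (fun i => measurableSet_disjoint_closedCompl (isOpen_basisSeq i))
    fun m => (closedCompl m).isCompact.isClosed

lemma measurableSet_mem_frontier_hull (hE : Convex ℝ (E : Set ℝᵈ)) :
    MeasurableSet {p : PointMeasure E × ℝᵈ | p.2 ∈ frontier (hull p.1)} := by
  simp only [(isClosed_hull _).frontier_eq]
  exact measurableSet_mem_hull.diff (measurableSet_mem_interior_hull hE)

lemma measurable_interiorCount (hE : Convex ℝ (E : Set ℝᵈ)) :
    Measurable (interiorCount : PointMeasure E → ℝ≥0∞) :=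
  measurable_measure_prodMk_preimage measurable_subtype_coe (measurableSet_mem_interior_hull hE)

lemma measurable_boundaryCount (hE : Convex ℝ (E : Set ℝᵈ)) :
    Measurable (boundaryCount : PointMeasure E → ℝ≥0∞) :=
  measurable_measure_prodMk_preimage measurable_subtype_coe (measurableSet_mem_frontier_hull hE)

variable {m : PointMeasure E} {K : Compacts (EuclideanSpace ℝ (Fin d))}

lemma atoms_inter_frontier_hull_subset (hE : Convex ℝ (E : Set ℝᵈ))
    (hm : m.1 (frontier (E : Set ℝᵈ)) = 0) (hK : closedCompl m ≤ K) :
    atoms m ∩ frontier (hull m) ⊆ K := by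
  rintro x ⟨hx, hxf⟩
  refine hK ?_
  by_contra hxc
  refine hxf.2 ?_
  rw [interior_hull_eq_diff_closedCompl hE]
  exact ⟨atoms_subset_interior hm hx, hxc⟩

lemma hull_restr_of_closedCompl_le (hd : 0 < d) (hE : Convex ℝ (E : Set ℝᵈ))
    (hm : m.1 (frontier (E : Set ℝᵈ)) = 0) (hK : closedCompl m ≤ K) :
    hull (restr m K) = hull m :=
  hull_restr_eq fun _ hx => atoms_inter_frontier_hull_subset hE hm hK
    ⟨extremePoints_hull_subset_atoms m hx, extremePoints_hull_subset_frontier hd m hx⟩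

lemma closedCompl_restr_le_iff (hd : 0 < d) (hE : Convex ℝ (E : Set ℝᵈ))
    (hm : m.1 (frontier (E : Set ℝᵈ)) = 0) :
    closedCompl (restr m K) ≤ K ↔ closedCompl m ≤ K := by
  refine ⟨fun h => ?_, fun h => ?_⟩
  · rw [closedCompl_le_iff] at h ⊢
    exact h.trans (hull_restr_subset m K)
  · rwa [closedCompl_le_iff, hull_restr_of_closedCompl_le hd hE hm h, ← closedCompl_le_iff]

lemma boundaryCount_restr_of_closedCompl_le (hd : 0 < d) (hE : Convex ℝ (E : Set ℝᵈ))
    (hm : m.1 (frontier (E : Set ℝᵈ)) = 0) (hK : closedCompl m ≤ K) :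
    boundaryCount (restr m K) = boundaryCount m := by
  rw [boundaryCount, hull_restr_of_closedCompl_le hd hE hm hK,
    measure_restr m K isClosed_frontier.measurableSet]
  exact measure_congr_atoms m fun x hx =>
    ⟨fun hxK => hxK.1, fun hxf => ⟨hxf, atoms_inter_frontier_hull_subset hE hm hK ⟨hx, hxf⟩⟩⟩

end ClosedCompl

section Sigma

variable {Ω : Type*}

lemma countSigma_eq_comap (𝒩 : Ω → PointMeasure E) (K : Compacts ℝᵈ) :
    countSigma 𝒩 K = MeasurableSpace.comap (fun ω => restr (𝒩 ω) K) inferInstance := by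
  apply le_antisymm
  · refine iSup₂_le fun U hU => measurable_iff_comap_le.1 ?_
    have hU' (ω : Ω) : (𝒩 ω).1 U = (restr (𝒩 ω) K).1 U := by
      rw [measure_restr _ _ U.isCompact.measurableSet, Set.inter_eq_left.2 hU]
    simp only [hU']
    exact (measurable_eval U.isCompact.measurableSet).comp (comap_measurable _)
  · let _ := countSigma 𝒩 K
    have key : ∀ U ≤ K, Measurable fun ω => (𝒩 ω).1 (U : Set ℝᵈ) :=
      fun U hU => measurable_iff_comap_le.2 (le_iSup₂_of_le U hU le_rfl)
    refine measurable_iff_comap_le.1 (Measurable.subtype_mk ?_)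
    refine Measurable.measure_of_isPiSystem (S := {F | IsClosed F})
      (BorelSpace.measurable_eq.trans borel_eq_generateFrom_isClosed) isPiSystem_isClosed
      (fun F (hF : IsClosed F) => ?_) ?_
    · simp only [Measure.restrict_apply hF.measurableSet]
      exact key ⟨F ∩ K, K.isCompact.inter_left hF⟩ Set.inter_subset_right
    · simp only [Measure.restrict_apply_univ]
      exact key K le_rfl

lemma measurable_countSigma_restr (𝒩 : Ω → PointMeasure E) (K : Compacts ℝᵈ) :
    Measurable[countSigma 𝒩 K] fun ω => restr (𝒩 ω) K := by
  rw [countSigma_eq_comap]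
  exact comap_measurable _

lemma measurable_countSigma (𝒩 : Ω → PointMeasure E) : Measurable[countSigma 𝒩 E] 𝒩 := by
  simpa only [restr_eq_self (atoms_subset _)] using measurable_countSigma_restr 𝒩 E

lemma monotone_countSigma (𝒩 : Ω → PointMeasure E) : Monotone (countSigma 𝒩) :=
  fun _ _ hKL => iSup₂_le fun U hU => le_iSup₂_of_le U (hU.trans hKL) le_rfl

variable {m : MeasurableSpace Ω} [mΩ : MeasurableSpace Ω] {P : Measure Ω} {𝒩 : Ω → PointMeasure E}

lemma countSigma_le (h𝒩 : Measurable 𝒩) (K : Compacts ℝᵈ) : countSigma 𝒩 K ≤ mΩ :=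
  iSup₂_le fun U _ => measurable_iff_comap_le.1
    ((measurable_eval U.isCompact.measurableSet).comp h𝒩)

lemma complete_eq_inf (hm : m ≤ countSigma 𝒩 E) :
    complete P 𝒩 m = countSigma 𝒩 E ⊓ eventuallyMeasurableSpace m (ae P) := by
  apply le_antisymm
  · refine sup_le (le_inf hm le_eventuallyMeasurableSpace)
      (le_inf (MeasurableSpace.generateFrom_le fun Z hZ => hZ.1)
        (MeasurableSpace.generateFrom_le fun Z hZ => ?_))
    exact ⟨∅, @MeasurableSet.empty _ m, ae_eq_empty.2 hZ.2⟩
  · intro A hA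
    obtain ⟨hA, B, hB, hAB⟩ := MeasurableSpace.measurableSet_inf.1 hA
    have hm_le : m ≤ complete P 𝒩 m := le_sup_left
    have hnull (Z) (hZ : MeasurableSet[countSigma 𝒩 E] Z) (hZ0 : P Z = 0) :
        MeasurableSet[complete P 𝒩 m] Z :=
      (le_sup_right : _ ≤ complete P 𝒩 m) Z (MeasurableSpace.measurableSet_generateFrom ⟨hZ, hZ0⟩)
    have hdiff := hnull (A \ B) (hA.diff (hm B hB)) (ae_le_set.1 hAB.le)
    have hdiff' := hnull (B \ A) (.diff (hm B hB) hA) (ae_le_set.1 hAB.symm.le)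
    rw [← Set.sdiff_union_inter A B, Set.inter_comm, ← Set.sdiff_sdiff_right_self]
    exact hdiff.union (.diff (hm_le B hB) hdiff')

lemma measurableSet_natFiltration_iff {K : Compacts ℝᵈ} (hK : K ≤ E) {A : Set Ω} :
    MeasurableSet[natFiltration P 𝒩 K] A ↔ MeasurableSet[countSigma 𝒩 E] A ∧
      ∃ T : Set (PointMeasure E), MeasurableSet T ∧ A =ᵐ[P] {ω | restr (𝒩 ω) K ∈ T} := by
  rw [natFiltration, complete_eq_inf (monotone_countSigma 𝒩 hK)]
  refine MeasurableSpace.measurableSet_inf.trans (and_congr_right fun _ => ?_)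
  rw [countSigma_eq_comap]
  constructor
  · rintro ⟨_, ⟨T, hT, rfl⟩, h⟩
    exact ⟨T, hT, h⟩
  · rintro ⟨T, hT, h⟩
    exact ⟨_, ⟨T, hT, rfl⟩, h⟩

lemma monotone_natFiltration : Monotone (natFiltration P 𝒩) :=
  fun _ _ hKL => sup_le_sup_right (monotone_countSigma 𝒩 hKL) _

lemma totalSigma_natFiltration : totalSigma E (natFiltration P 𝒩) = countSigma 𝒩 E := by
  apply le_antisymm
  · exact iSup₂_le fun K hK A hA => ((measurableSet_natFiltration_iff hK).1 hA).1
  · exact le_iSup₂_of_le E le_rfl le_sup_left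

end Sigma

namespace IsStoppingSet

variable {Ω : Type*} {𝓕 : Compacts (EuclideanSpace ℝ (Fin d)) → MeasurableSpace Ω}
  {𝒦 : Ω → Compacts (EuclideanSpace ℝ (Fin d))}

lemma history_le_totalSigma (h : IsStoppingSet E 𝓕 𝒦) : h.history ≤ totalSigma E 𝓕 :=
  fun _ hA => hA.1

lemma measurableSet_history_le (h : IsStoppingSet E 𝓕 𝒦) (h𝓕 : Monotone 𝓕) {K : Compacts ℝᵈ}
    (hK : K ≤ E) : MeasurableSet[h.history] {ω | 𝒦 ω ≤ K} := by
  refine ⟨le_iSup₂ (f := fun L (_ : L ≤ E) => 𝓕 L) K hK _ (h.measurableSet_le K hK),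
    fun L _ => ?_⟩
  have hKL : {ω | 𝒦 ω ≤ K} ∩ {ω | 𝒦 ω ≤ L} = {ω | 𝒦 ω ≤ K ⊓ L} := by
    simp only [le_inf_iff, Set.ofPred_and]
  rw [hKL]
  exact h𝓕 inf_le_right _ (h.measurableSet_le _ (inf_le_left.trans hK))

lemma measurableSet_history_disjoint_basisSeq (h : IsStoppingSet E 𝓕 𝒦) (h𝓕 : Monotone 𝓕)
    (i : ℕ) : MeasurableSet[h.history] {ω | Disjoint (basisSeq ℝᵈ i) (𝒦 ω)} := by
  simpa [le_removeBasis_iff (h.subset _)] using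
    h.measurableSet_history_le h𝓕 (removeBasis_le E {i})

lemma measurableSet_inter_missed_eq (h : IsStoppingSet E 𝓕 𝒦) (h𝓕 : Monotone 𝓕) {A : Set Ω}
    (hA : MeasurableSet[h.history] A) (n : ℕ) (I : Finset ℕ) :
    MeasurableSet[𝓕 (removeBasis E I)] (A ∩ {ω | missed (𝒦 ω : Set ℝᵈ) n = I}) := by
  have hmissed : MeasurableSet[h.history] {ω | missed (𝒦 ω : Set ℝᵈ) n = I} :=
    @measurableSet_missed_eq _ _ _ _ h.history _ (h.measurableSet_history_disjoint_basisSeq h𝓕) n I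
  have hle : {ω | missed (𝒦 ω : Set ℝᵈ) n = I} ⊆ {ω | 𝒦 ω ≤ removeBasis E I} := by
    rintro ω rfl
    exact (le_removeBasis_iff (h.subset ω) _).2 fun i hi => (mem_missed.1 hi).2
  have := (hA.inter hmissed).2 _ (removeBasis_le E I)
  rwa [Set.inter_assoc, Set.inter_eq_left.2 hle] at this

end IsStoppingSet

namespace IsPoissonPointProcess

variable {Ω : Type*} [MeasurableSpace Ω] {P : Measure Ω} {lam : ℝ≥0}
  {C : Set (EuclideanSpace ℝ (Fin d))} {𝒩 : Ω → PointMeasure E}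

lemma measurable_count (h : IsPoissonPointProcess P lam C 𝒩) {A : Set ℝᵈ}
    (hA : MeasurableSet A) : Measurable fun ω => (𝒩 ω).1 A :=
  (measurable_eval hA).comp h.measurable

lemma measure_count_mem (h : IsPoissonPointProcess P lam C 𝒩) {A : Set ℝᵈ}
    (hA : MeasurableSet A) (hAE : A ⊆ E) {s : Set ℝ≥0∞} (hs : MeasurableSet s) :
    P {ω | (𝒩 ω).1 A ∈ s} =
      poissonMeasure (lam * (volume (A ∩ C)).toNNReal) {n : ℕ | (n : ℝ≥0∞) ∈ s} := by
  have hlaw := congrArg (fun μ => μ s) (h.law A hA hAE)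
  beta_reduce at hlaw
  rwa [Measure.map_apply (h.measurable_count hA) hs, Measure.map_apply .of_discrete hs] at hlaw

lemma measure_count_eq (h : IsPoissonPointProcess P lam C 𝒩) {A : Set ℝᵈ}
    (hA : MeasurableSet A) (hAE : A ⊆ E) (k : ℕ) :
    P {ω | (𝒩 ω).1 A = k} = poissonMeasure (lam * (volume (A ∩ C)).toNNReal) {k} := by
  simpa [Nat.cast_inj] using h.measure_count_mem hA hAE (measurableSet_singleton (k : ℝ≥0∞))

lemma measure_two_le_count_le (h : IsPoissonPointProcess P lam C 𝒩) {A : Set ℝᵈ}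
    (hA : MeasurableSet A) (hAE : A ⊆ E) :
    P {ω | 2 ≤ (𝒩 ω).1 A} ≤ (lam * volume (A ∩ C)) ^ 2 := by
  have hlaw := h.measure_count_mem hA hAE (measurableSet_Ici (a := 2))
  simp only [Set.mem_Ici, Nat.ofNat_le_cast] at hlaw
  rw [hlaw]
  refine (poissonMeasure_two_le _).trans ?_
  rw [ENNReal.coe_mul]
  gcongr
  exact ENNReal.coe_toNNReal_le_self

lemma ae_count_eq_zero [IsProbabilityMeasure P] (h : IsPoissonPointProcess P lam C 𝒩) {A : Set ℝᵈ}
    (hA : MeasurableSet A) (hAE : A ⊆ E) (h0 : volume (A ∩ C) = 0) :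
    ∀ᵐ ω ∂P, (𝒩 ω).1 A = 0 := by
  have hcount := h.measure_count_eq hA hAE 0
  rw [poissonMeasure_singleton, h0] at hcount
  refine (prob_compl_eq_zero_iff (h.measurable_count hA (measurableSet_singleton 0))).2 ?_
  simpa [Set.preimage, Set.mem_singleton_iff] using hcount

lemma ae_frontier_eq_zero [IsProbabilityMeasure P] (h : IsPoissonPointProcess P lam C 𝒩)
    (hE : Convex ℝ (E : Set ℝᵈ)) : ∀ᵐ ω ∂P, (𝒩 ω).1 (frontier (E : Set ℝᵈ)) = 0 :=
  h.ae_count_eq_zero isClosed_frontier.measurableSet E.isCompact.isClosed.frontier_subset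
    (measure_mono_null Set.inter_subset_left (hE.addHaar_frontier volume))

lemma indepFun_restr [IsProbabilityMeasure P] (h : IsPoissonPointProcess P lam C 𝒩) {K L : Set ℝᵈ}
    (hK : MeasurableSet K) (hL : MeasurableSet L) (hKE : K ⊆ E) (hLE : L ⊆ E)
    (hKL : Disjoint K L) : IndepFun (fun ω => restr (𝒩 ω) K) (fun ω => restr (𝒩 ω) L) P := by
  rw [IndepFun_iff_Indep]
  simp only [Subtype.instMeasurableSpace, MeasurableSpace.comap_comp]
  exact (IndepFun_iff_Indep _ _ _).1 <| indepFun_restrict_of_disjoint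
    (measurable_subtype_coe.comp h.measurable) h.indep hK hL hKE hLE hKL

-- In a partition into cells of volume less than `ε`, two points share a cell with probability
-- `O(ε)`.
lemma measure_exists_one_lt_singleton_le (h : IsPoissonPointProcess P lam C 𝒩) (hd : 0 < d)
    {ε : ℝ≥0∞} (hε : 0 < ε) :
    P {ω | ∃ x, 1 < (𝒩 ω).1 {x}} ≤ ε * (lam ^ 2 * volume (E : Set ℝᵈ)) := by
  have : Nonempty (Fin d) := ⟨⟨0, hd⟩⟩
  obtain ⟨D, hD, hdisj, hcover, hDε⟩ :=
    exists_disjoint_cover_measure_lt (volume : Measure ℝᵈ) hε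
  have hDE (n : ℕ) : MeasurableSet (D n ∩ E) := (hD n).inter E.isCompact.measurableSet
  have hsub : {ω | ∃ x, 1 < (𝒩 ω).1 {x}} ⊆ ⋃ n, {ω | 2 ≤ (𝒩 ω).1 (D n ∩ E)} := by
    rintro ω ⟨x, hx⟩
    obtain ⟨n, hxn⟩ := Set.mem_iUnion.1 (hcover ▸ Set.mem_univ x)
    have hxE : x ∈ (E : Set ℝᵈ) := atoms_subset (𝒩 ω) (zero_lt_one.trans hx).ne'
    have hlt : 1 < (𝒩 ω).1 (D n ∩ E) :=
      hx.trans_le (measure_mono (Set.singleton_subset_iff.2 ⟨hxn, hxE⟩))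
    refine Set.mem_iUnion.2 ⟨n, Set.mem_ofPred_eq ▸ ?_⟩
    obtain ⟨k, hk⟩ := (𝒩 ω).2.2 _ (hDE n)
    rw [hk] at hlt ⊢
    exact_mod_cast hlt
  calc P {ω | ∃ x, 1 < (𝒩 ω).1 {x}}
      ≤ ∑' n, P {ω | 2 ≤ (𝒩 ω).1 (D n ∩ E)} := (measure_mono hsub).trans (measure_iUnion_le _)
    _ ≤ ∑' n, ε * lam ^ 2 * volume (D n ∩ E) := by
        refine ENNReal.tsum_le_tsum fun n =>
          (h.measure_two_le_count_le (hDE n) Set.inter_subset_right).trans ?_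
        calc (lam * volume (D n ∩ E ∩ C)) ^ 2
            = volume (D n ∩ E ∩ C) * lam ^ 2 * volume (D n ∩ E ∩ C) := by ring
          _ ≤ ε * lam ^ 2 * volume (D n ∩ E) := by
              have hle : volume (D n ∩ E ∩ C) ≤ volume (D n ∩ E) :=
                measure_mono Set.inter_subset_left
              have hlt : volume (D n ∩ E) ≤ ε :=
                (measure_mono Set.inter_subset_left).trans (hDε n).le
              exact mul_le_mul' (by gcongr; exact hle.trans hlt) hle
    _ = ε * (lam ^ 2 * volume (E : Set ℝᵈ)) := by
        rw [ENNReal.tsum_mul_left, ← measure_iUnion (fun i j hij => (hdisj hij).mono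
          Set.inter_subset_left Set.inter_subset_left) hDE, ← Set.iUnion_inter, hcover,
          Set.univ_inter, mul_assoc]

lemma ae_singleton_le_one (h : IsPoissonPointProcess P lam C 𝒩) (hd : 0 < d) :
    ∀ᵐ ω ∂P, ∀ x, (𝒩 ω).1 {x} ≤ 1 := by
  have hlim : Tendsto (fun ε : ℝ≥0∞ => ε * (lam ^ 2 * volume (E : Set ℝᵈ))) (𝓝[>] 0) (𝓝 0) := by
    have hfin : (lam : ℝ≥0∞) ^ 2 * volume (E : Set ℝᵈ) ≠ ∞ :=
      ENNReal.mul_ne_top (by simp) E.isCompact.measure_ne_top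
    simpa using (ENNReal.Tendsto.mul_const tendsto_id (Or.inr hfin)).mono_left
      (nhdsWithin_le_nhds (a := (0 : ℝ≥0∞)))
  simp only [ae_iff, not_forall, not_le]
  exact le_antisymm (ge_of_tendsto hlim <| eventually_nhdsWithin_of_forall fun _ hε =>
    h.measure_exists_one_lt_singleton_le hd hε) zero_le

lemma ae_disjoint_frontier_hull_restr [IsProbabilityMeasure P]
    (h : IsPoissonPointProcess P lam C 𝒩) (hE : Convex ℝ (E : Set ℝᵈ)) {U : Set ℝᵈ}
    (hU : MeasurableSet U) :
    ∀ᵐ ω ∂P, Disjoint (atoms (𝒩 ω) ∩ U) (frontier (hull (restr (𝒩 ω) (E \ U)))) := by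
  have hUE : MeasurableSet (U ∩ E) := hU.inter E.isCompact.measurableSet
  have hEU : MeasurableSet (E \ U) := E.isCompact.measurableSet.diff hU
  have hindep := h.indepFun_restr hEU hUE Set.sdiff_subset Set.inter_subset_right
    (Set.disjoint_sdiff_left.mono_right Set.inter_subset_left)
  have hae := ae_measure_prodMk_preimage_eq_zero ((measurable_restr hEU).comp h.measurable)
    ((measurable_restr hUE).comp h.measurable) hindep measurable_subtype_coe
    (measurableSet_mem_frontier_hull hE) fun m => ?_
  · filter_upwards [hae] with ω hω
    have hω : Disjoint (frontier (hull (restr (𝒩 ω) (E \ U)))) (atoms (restr (𝒩 ω) (U ∩ E))) :=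
      (measure_eq_zero_iff_disjoint_atoms _ _).1 hω
    rw [atoms_restr] at hω
    have hsub : atoms (𝒩 ω) ∩ U ⊆ atoms (𝒩 ω) ∩ (U ∩ E) :=
      fun x hx => ⟨hx.1, hx.2, atoms_subset _ hx.1⟩
    exact (hω.mono_right hsub).symm
  · have hnull : volume (frontier (hull m) ∩ (U ∩ E) ∩ C) = 0 :=
      measure_mono_null (Set.inter_subset_left.trans Set.inter_subset_left)
        ((convex_hull m).addHaar_frontier volume)
    filter_upwards [h.ae_count_eq_zero (isClosed_frontier.measurableSet.inter hUE)
      (Set.inter_subset_right.trans Set.inter_subset_right) hnull] with ω hω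
    exact (measure_restr _ _ isClosed_frontier.measurableSet).trans hω

lemma ae_atoms_inter_frontier_hull_subset [IsProbabilityMeasure P]
    (h : IsPoissonPointProcess P lam C 𝒩) (hE : Convex ℝ (E : Set ℝᵈ)) :
    ∀ᵐ ω ∂P, atoms (𝒩 ω) ∩ frontier (hull (𝒩 ω)) ⊆ (hull (𝒩 ω)).extremePoints ℝ := by
  filter_upwards [ae_all_iff.2 fun i =>
    h.ae_disjoint_frontier_hull_restr hE (isOpen_basisSeq i).measurableSet] with ω hω
  rintro x ⟨hx, hxf⟩
  by_contra hxe
  obtain ⟨_, ⟨i, rfl⟩, hxi, hi⟩ := isTopologicalBasis_basisSeq.exists_subset_of_mem_open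
    (show x ∈ (atoms (𝒩 ω) \ {x})ᶜ by simp)
    ((finite_atoms (𝒩 ω)).subset Set.sdiff_subset).isClosed.isOpen_compl
  have hextreme : (hull (𝒩 ω)).extremePoints ℝ ⊆ E \ basisSeq ℝᵈ i := fun y hy =>
    have hya := extremePoints_hull_subset_atoms _ hy
    ⟨atoms_subset _ hya, fun hyi => hi hyi ⟨hya, fun hyx => hxe (hyx ▸ hy)⟩⟩
  refine Set.disjoint_left.1 (hω i) ⟨hx, hxi⟩ ?_
  rwa [hull_restr_eq hextreme]

end IsPoissonPointProcess

section StrongMarkov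

lemma measurableSet_inter_basisUnion (I : Finset ℕ) :
    MeasurableSet ((E : Set ℝᵈ) ∩ basisUnion I) :=
  E.isCompact.measurableSet.inter (isOpen_basisUnion I).measurableSet

lemma tendsto_volume_basisUnion_missed (K : Compacts ℝᵈ) (C : Set ℝᵈ) :
    Tendsto (fun n => (volume (E ∩ basisUnion (missed (K : Set ℝᵈ) n) ∩ C)).toNNReal) atTop
      (𝓝 (volume (E \ K ∩ C : Set ℝᵈ)).toNNReal) := by
  have hmono : Monotone fun n => (E : Set ℝᵈ) ∩ basisUnion (missed (K : Set ℝᵈ) n) ∩ C :=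
    fun _ _ hnk => Set.inter_subset_inter_left _
      (Set.inter_subset_inter_right _ (monotone_basisUnion_missed _ hnk))
  have hlim := tendsto_measure_iUnion_atTop (μ := volume) hmono
  rw [← Set.iUnion_inter, ← Set.inter_iUnion, iUnion_basisUnion_missed K.isCompact.isClosed,
    ← Set.sdiff_eq] at hlim
  exact (ENNReal.tendsto_toNNReal (measure_mono_top
    (Set.inter_subset_left.trans Set.sdiff_subset) |>.mt E.isCompact.measure_ne_top)).comp hlim

lemma IsStoppingSet.measurable_history_volume_diff {Ω : Type*} {𝓕 : Compacts ℝᵈ → MeasurableSpace Ω}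
    {𝒦 : Ω → Compacts ℝᵈ} (h : IsStoppingSet E 𝓕 𝒦) (h𝓕 : Monotone 𝓕) (C : Set ℝᵈ) :
    Measurable[h.history] fun ω => volume ((E : Set ℝᵈ) \ 𝒦 ω ∩ C) := by
  have hE_meas : MeasurableSet (E : Set ℝᵈ) := E.isCompact.measurableSet
  have : IsFiniteMeasure (volume.restrict (E ∩ C : Set ℝᵈ)) :=
    isFiniteMeasure_restrict.2
      (measure_mono_top Set.inter_subset_left |>.mt E.isCompact.measure_ne_top)
  have hrestrict (ω : Ω) :
      volume ((E : Set ℝᵈ) \ 𝒦 ω ∩ C) = volume.restrict (E ∩ C : Set ℝᵈ) (E \ 𝒦 ω) := by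
    rw [Measure.restrict_apply (hE_meas.diff (𝒦 ω).isCompact.measurableSet),
      ← Set.inter_assoc, Set.inter_eq_left.2 Set.sdiff_subset]
  simp only [hrestrict]
  exact @measurable_measure_diff _ _ _ _ h.history _ _ _
    (h.measurableSet_history_disjoint_basisSeq h𝓕) (fun ω => (𝒦 ω).isCompact.isClosed)
    (fun _ => volume.restrict (E ∩ C : Set ℝᵈ)) _ (@measurable_const _ _ _ h.history _) _ hE_meas

namespace IsPoissonPointProcess

variable {Ω : Type*} [mΩ : MeasurableSpace Ω] {P : Measure Ω}
  {lam : ℝ≥0} {C : Set (EuclideanSpace ℝ (Fin d))} {𝒩 : Ω → PointMeasure E}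
  {𝒦 : Ω → Compacts (EuclideanSpace ℝ (Fin d))}

lemma history_le (h : IsPoissonPointProcess P lam C 𝒩)
    (h𝒦 : IsStoppingSet E (natFiltration P 𝒩) 𝒦) : h𝒦.history ≤ mΩ :=
  h𝒦.history_le_totalSigma.trans
    (totalSigma_natFiltration.trans_le (countSigma_le h.measurable E))

lemma measurableSet_disjoint_basisSeq (h : IsPoissonPointProcess P lam C 𝒩)
    (h𝒦 : IsStoppingSet E (natFiltration P 𝒩) 𝒦) (i : ℕ) :
    MeasurableSet {ω | Disjoint (basisSeq ℝᵈ i) (𝒦 ω)} :=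
  h.history_le h𝒦 _ (h𝒦.measurableSet_history_disjoint_basisSeq monotone_natFiltration i)

lemma measurable_count_diff (h : IsPoissonPointProcess P lam C 𝒩)
    (h𝒦 : IsStoppingSet E (natFiltration P 𝒩) 𝒦) :
    Measurable fun ω => (𝒩 ω).1 (E \ 𝒦 ω) :=
  measurable_measure_diff (h.measurableSet_disjoint_basisSeq h𝒦)
    (fun ω => (𝒦 ω).isCompact.isClosed) (κ := fun ω => (𝒩 ω).1)
    (measurable_subtype_coe.comp h.measurable) E.isCompact.measurableSet

variable [IsProbabilityMeasure P]

lemma measure_inter_count_eq (h : IsPoissonPointProcess P lam C 𝒩) {K : Compacts ℝᵈ} (hK : K ≤ E)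
    {A : Set Ω} (hA : MeasurableSet[natFiltration P 𝒩 K] A) {L : Set ℝᵈ} (hL : MeasurableSet L)
    (hLE : L ⊆ E) (hKL : Disjoint (K : Set ℝᵈ) L) (k : ℕ) :
    P (A ∩ {ω | (𝒩 ω).1 L = k}) =
      P A * poissonMeasure (lam * (volume (L ∩ C)).toNNReal) {k} := by
  obtain ⟨-, T, hT, hAT⟩ := (measurableSet_natFiltration_iff hK).1 hA
  have hindep := h.indepFun_restr K.isCompact.measurableSet hL hK hLE hKL
    |>.measure_inter_preimage_eq_mul T {m | m.1 L = k} hT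
      (measurable_eval hL (measurableSet_singleton _))
  have hcount (ω : Ω) : (restr (𝒩 ω) L).1 L = (𝒩 ω).1 L := by
    rw [measure_restr _ _ hL, Set.inter_self]
  simp only [Set.preimage_ofPred_eq, hcount] at hindep
  have hAT' : (A ∩ {ω | (𝒩 ω).1 L = k} : Set Ω) =ᵐ[P]
      ({ω | restr (𝒩 ω) K ∈ T} ∩ {ω | (𝒩 ω).1 L = k} : Set Ω) := hAT.inter (ae_eq_refl _)
  rw [measure_congr hAT', measure_congr hAT, ← h.measure_count_eq hL hLE]
  exact hindep

lemma measure_inter_count_basisUnion_missed (h : IsPoissonPointProcess P lam C 𝒩)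
    (h𝒦 : IsStoppingSet E (natFiltration P 𝒩) 𝒦) {A : Set Ω} (hA : MeasurableSet[h𝒦.history] A)
    (n k : ℕ) :
    P (A ∩ {ω | (𝒩 ω).1 (E ∩ basisUnion (missed (𝒦 ω : Set ℝᵈ) n)) = k}) =
      ∫⁻ ω in A, poissonMeasure
        (lam * (volume (E ∩ basisUnion (missed (𝒦 ω : Set ℝᵈ) n) ∩ C)).toNNReal) {k} ∂P := by
  set B : Finset ℕ → Set Ω := fun I => A ∩ {ω | missed (𝒦 ω : Set ℝᵈ) n = I} with hB
  have hBm (I : Finset ℕ) : MeasurableSet (B I) :=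
    (h.history_le h𝒦 A hA).inter
      (measurableSet_missed_eq (h.measurableSet_disjoint_basisSeq h𝒦) n I)
  have hBdisj : Pairwise fun I J => Disjoint (B I) (B J) := fun I J hIJ =>
    Set.disjoint_left.2 fun ω h1 h2 => hIJ (h1.2.symm.trans h2.2)
  have hcount (I : Finset ℕ) :
      MeasurableSet {ω | (𝒩 ω).1 (E ∩ basisUnion I) = k} :=
    h.measurable_count (measurableSet_inter_basisUnion I) (measurableSet_singleton _)
  have hA_eq : A = ⋃ I, B I := by ext ω; simp [hB]
  have hinter : A ∩ {ω | (𝒩 ω).1 (E ∩ basisUnion (missed (𝒦 ω : Set ℝᵈ) n)) = k} =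
      ⋃ I, B I ∩ {ω | (𝒩 ω).1 (E ∩ basisUnion I) = k} := by ext ω; simp [hB]
  rw [hinter, measure_iUnion (fun I J hIJ =>
      (hBdisj hIJ).mono Set.inter_subset_left Set.inter_subset_left)
    (fun I => (hBm I).inter (hcount I))]
  conv_rhs => rw [hA_eq]
  rw [lintegral_iUnion hBm hBdisj]
  refine tsum_congr fun I => ?_
  rw [h.measure_inter_count_eq (removeBasis_le E I)
    (h𝒦.measurableSet_inter_missed_eq monotone_natFiltration hA n I)
    (measurableSet_inter_basisUnion I) Set.inter_subset_left
    (Set.disjoint_sdiff_left.mono_right Set.inter_subset_right), mul_comm, ← setLIntegral_const]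
  exact setLIntegral_congr_fun (hBm I) fun ω hω => by rw [hω.2]

lemma measure_inter_count_diff (h : IsPoissonPointProcess P lam C 𝒩)
    (h𝒦 : IsStoppingSet E (natFiltration P 𝒩) 𝒦) {A : Set Ω} (hA : MeasurableSet[h𝒦.history] A)
    (k : ℕ) :
    P (A ∩ {ω | (𝒩 ω).1 (E \ 𝒦 ω) = k}) =
      ∫⁻ ω in A, poissonMeasure (lam * (volume ((E : Set ℝᵈ) \ 𝒦 ω ∩ C)).toNNReal) {k} ∂P := by
  have hA' : MeasurableSet A := h.history_le h𝒦 A hA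
  refine tendsto_nhds_unique (l := atTop) (f := fun n =>
    P (A ∩ {ω | (𝒩 ω).1 (E ∩ basisUnion (missed (𝒦 ω : Set ℝᵈ) n)) = k})) ?_ ?_
  · refine tendsto_measure_of_ae_tendsto_indicator (μ := P) atTop
      (hA'.inter (h.measurable_count_diff h𝒦 (measurableSet_singleton _)))
      (fun n => hA'.inter ?_) MeasurableSet.univ (by simp) (by simp) (.of_forall fun ω => ?_)
    · exact measurable_apply_missed (h.measurableSet_disjoint_basisSeq h𝒦) n
        (f := fun I ω => (𝒩 ω).1 (E ∩ basisUnion I))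
        (fun I => h.measurable_count (measurableSet_inter_basisUnion I)) (measurableSet_singleton _)
    filter_upwards [eventually_mem_basisUnion_missed (𝒦 ω).isCompact.isClosed
      (finite_atoms (𝒩 ω))] with n hn
    have hcongr : (𝒩 ω).1 (E ∩ basisUnion (missed (𝒦 ω : Set ℝᵈ) n)) = (𝒩 ω).1 (E \ 𝒦 ω) :=
      measure_congr_atoms _ fun x hx => and_congr_right fun _ => hn x hx
    simp only [Set.mem_inter_iff, Set.mem_ofPred_eq, hcongr]
  · simp only [h.measure_inter_count_basisUnion_missed h𝒦 hA]
    refine tendsto_lintegral_of_dominated_convergence (fun _ => 1) (fun n => ?_)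
      (fun n => .of_forall fun ω => prob_le_one) (by simp) (.of_forall fun ω => ?_)
    · exact measurable_apply_missed (h.measurableSet_disjoint_basisSeq h𝒦) n
        (f := fun I _ => poissonMeasure (lam * (volume (E ∩ basisUnion I ∩ C)).toNNReal) {k})
        fun I => measurable_const
    · exact ((continuous_poissonMeasure_singleton k).tendsto _).comp
        ((tendsto_volume_basisUnion_missed (𝒦 ω) C).const_mul lam)

lemma condExp_count_diff (h : IsPoissonPointProcess P lam C 𝒩)
    (h𝒦 : IsStoppingSet E (natFiltration P 𝒩) 𝒦) (k : ℕ) :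
    P[Set.indicator {ω | (𝒩 ω).1 (E \ 𝒦 ω) = k} (fun _ => (1 : ℝ)) | h𝒦.history] =ᵐ[P]
      fun ω => (poissonMeasure (lam * (volume ((E : Set ℝᵈ) \ 𝒦 ω ∩ C)).toNNReal)).real {k} := by
  have hS : MeasurableSet {ω | (𝒩 ω).1 (E \ 𝒦 ω) = k} :=
    h.measurable_count_diff h𝒦 (measurableSet_singleton _)
  have hf : Measurable[h𝒦.history] fun ω =>
      poissonMeasure (lam * (volume ((E : Set ℝᵈ) \ 𝒦 ω ∩ C)).toNNReal) {k} :=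
    (continuous_poissonMeasure_singleton k).measurable.comp
      ((h𝒦.measurable_history_volume_diff monotone_natFiltration C).ennreal_toNNReal.const_mul lam)
  have hle := h.history_le h𝒦
  refine (ae_eq_condExp_of_forall_setIntegral_eq hle
    ((integrable_const (1 : ℝ)).indicator hS) (fun s _ _ => ?_) (fun s hs _ => ?_)
    hf.ennreal_toReal.stronglyMeasurable.aestronglyMeasurable).symm
  · refine (Integrable.of_bound (hf.ennreal_toReal.mono hle le_rfl).aestronglyMeasurable 1
      (.of_forall fun ω => ?_)).integrableOn
    rw [Real.norm_of_nonneg ENNReal.toReal_nonneg]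
    exact measureReal_le_one
  · rw [integral_indicator_const _ hS, measureReal_restrict_apply hS, smul_eq_mul, mul_one]
    simp only [measureReal_def]
    rw [integral_toReal (hf.mono hle le_rfl).aemeasurable (.of_forall fun ω => by simp),
      ← h.measure_inter_count_diff h𝒦 hs k, Set.inter_comm]

end IsPoissonPointProcess

end StrongMarkov

section HullHistory

lemma volume_diff_closedCompl_inter (hE : Convex ℝ (E : Set ℝᵈ)) (m : PointMeasure E)
    (C : Set ℝᵈ) : volume (E \ closedCompl m ∩ C) = volume (hull m ∩ C) := by
  refine measure_congr (.inter ?_ .rfl)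
  have hfrontier {s : Set ℝᵈ} (hs : Convex ℝ s) : interior s =ᵐ[volume] s :=
    interior_ae_eq_of_null_frontier (hs.addHaar_frontier volume)
  have hdiff : (E \ closedCompl m : Set ℝᵈ) =ᵐ[volume] interior (hull m) := by
    rw [interior_hull_eq_diff_closedCompl hE]
    exact (hfrontier hE).symm.diff .rfl
  exact hdiff.trans (hfrontier (convex_hull m))

lemma restr_closedCompl_eq_vertexMeasure (hd : 0 < d) (hE : Convex ℝ (E : Set ℝᵈ))
    {m : PointMeasure E} (hm : m.1 (frontier (E : Set ℝᵈ)) = 0) (hsimple : ∀ x, m.1 {x} ≤ 1)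
    (hext : atoms m ∩ frontier (hull m) ⊆ (hull m).extremePoints ℝ) :
    (restr m (closedCompl m)).1 = (hullPolytope m).vertexMeasure := by
  have hrestr : restr m (closedCompl m) = restr m ((hull m).extremePoints ℝ) :=
    restr_congr fun x hx => by
      refine ⟨fun hxc => hext ⟨hx, ?_⟩, fun hxe => ?_⟩
      · rw [(isClosed_hull m).frontier_eq, interior_hull_eq_diff_closedCompl hE]
        exact ⟨atoms_subset_hull m hx, fun hxi => hxi.2 hxc⟩
      · exact atoms_inter_frontier_hull_subset hE hm le_rfl
          ⟨hx, extremePoints_hull_subset_frontier hd m hxe⟩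
  rw [hrestr]
  refine restrict_eq_of_forall_singleton (hullPolytope m).finite_extremePoints.countable
    fun x hx => ?_
  rw [Measure.count_singleton]
  exact (hsimple x).antisymm (one_le_measure_of_ne_zero m (measurableSet_singleton x)
    (extremePoints_hull_subset_atoms m hx))

lemma generateFrom_hull_subset_eq_comap (hE : Convex ℝ (E : Set ℝᵈ)) {Ω : Type*}
    (𝒩 : Ω → PointMeasure E) :
    MeasurableSpace.generateFrom {s | ∃ B : Set ℝᵈ, Convex ℝ B ∧ IsClosed B ∧ B ⊆ E ∧
      s = {ω | hull (𝒩 ω) ⊆ B}} =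
    MeasurableSpace.comap (fun ω => hullPolytope (𝒩 ω)) inferInstance := by
  apply le_antisymm
  · refine MeasurableSpace.generateFrom_le ?_
    rintro _ ⟨B, hB, hB', -, rfl⟩
    exact ⟨_, Polytope.measurableSet_subset hB hB', rfl⟩
  · refine measurable_iff_comap_le.1 (@measurable_generateFrom _ _ (_) _ _ ?_)
    rintro _ ⟨B, hB, hB', rfl⟩
    refine MeasurableSpace.measurableSet_generateFrom ⟨B ∩ E, hB.inter hE,
      hB'.inter E.isCompact.isClosed, Set.inter_subset_right, ?_⟩
    ext ω
    exact (Set.subset_inter_iff.trans (and_iff_left (hull_subset hE _))).symm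

variable {Ω : Type*} {m : MeasurableSpace Ω} [mΩ : MeasurableSpace Ω] {P : Measure Ω}
  {𝒩 : Ω → PointMeasure E} {lam : ℝ≥0} {C : Set (EuclideanSpace ℝ (Fin d))}

namespace IsPoissonPointProcess

variable [IsProbabilityMeasure P]

lemma measurableSet_inter_closedCompl_le (h : IsPoissonPointProcess P lam C 𝒩) (hd : 0 < d)
    (hE : Convex ℝ (E : Set ℝᵈ)) {T : Set (PointMeasure E)} (hT : MeasurableSet T)
    {K : Compacts ℝᵈ} (hK : K ≤ E)
    (hTK : ∀ m : PointMeasure E, m.1 (frontier (E : Set ℝᵈ)) = 0 → closedCompl m ≤ K →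
      (restr m K ∈ T ↔ m ∈ T)) :
    MeasurableSet[natFiltration P 𝒩 K] ({ω | 𝒩 ω ∈ T} ∩ {ω | closedCompl (𝒩 ω) ≤ K}) := by
  have hT' := hT.inter (measurableSet_closedCompl_le K)
  refine (measurableSet_natFiltration_iff hK).2 ⟨measurable_countSigma 𝒩 hT', _, hT', ?_⟩
  filter_upwards [h.ae_frontier_eq_zero hE] with ω hω
  change (𝒩 ω ∈ T ∧ closedCompl (𝒩 ω) ≤ K) =
    (restr (𝒩 ω) K ∈ T ∧ closedCompl (restr (𝒩 ω) K) ≤ K)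
  rw [closedCompl_restr_le_iff hd hE hω]
  exact propext (and_congr_left fun hK => (hTK _ hω hK).symm)

lemma isStoppingSet_closedCompl (h : IsPoissonPointProcess P lam C 𝒩) (hd : 0 < d)
    (hE : Convex ℝ (E : Set ℝᵈ)) :
    IsStoppingSet E (natFiltration P 𝒩) fun ω => closedCompl (𝒩 ω) where
  subset ω := closedCompl_le (𝒩 ω)
  measurable := by
    rw [totalSigma_natFiltration]
    exact @measurable_compacts _ _ _ _ (countSigma 𝒩 E) _ _ _ (fun ω => closedCompl_le (𝒩 ω))
      fun i => measurable_countSigma 𝒩 (measurableSet_disjoint_closedCompl (isOpen_basisSeq i))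
  measurableSet_le K hK := by
    simpa using h.measurableSet_inter_closedCompl_le hd hE .univ hK fun _ _ _ => Iff.rfl

lemma measurable_history_closedCompl (h : IsPoissonPointProcess P lam C 𝒩) (hd : 0 < d)
    (hE : Convex ℝ (E : Set ℝᵈ)) {β : Type*} [MeasurableSpace β] {f : PointMeasure E → β}
    (hf : Measurable f)
    (hfK : ∀ (m : PointMeasure E) (K : Compacts ℝᵈ), m.1 (frontier (E : Set ℝᵈ)) = 0 →
      closedCompl m ≤ K → f (restr m K) = f m) :
    Measurable[(h.isStoppingSet_closedCompl hd hE).history] fun ω => f (𝒩 ω) := fun T hT =>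
  ⟨by rw [totalSigma_natFiltration]; exact measurable_countSigma 𝒩 (hf hT),
    fun K hK => h.measurableSet_inter_closedCompl_le hd hE (hf hT) hK fun m hm hmK => by
      rw [Set.mem_preimage, Set.mem_preimage, hfK m K hm hmK]⟩

lemma measurable_history_boundaryCount (h : IsPoissonPointProcess P lam C 𝒩) (hd : 0 < d)
    (hE : Convex ℝ (E : Set ℝᵈ)) :
    Measurable[(h.isStoppingSet_closedCompl hd hE).history] fun ω => boundaryCount (𝒩 ω) :=
  h.measurable_history_closedCompl hd hE (measurable_boundaryCount hE) fun _ _ hm hmK =>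
    boundaryCount_restr_of_closedCompl_le hd hE hm hmK

lemma measurable_history_hullPolytope (h : IsPoissonPointProcess P lam C 𝒩) (hd : 0 < d)
    (hE : Convex ℝ (E : Set ℝᵈ)) :
    Measurable[(h.isStoppingSet_closedCompl hd hE).history] fun ω => hullPolytope (𝒩 ω) :=
  h.measurable_history_closedCompl hd hE measurable_hullPolytope fun _ _ hm hmK =>
    Polytope.ext (hull_restr_of_closedCompl_le hd hE hm hmK)

lemma hullSigma_le_history (h : IsPoissonPointProcess P lam C 𝒩) (hd : 0 < d)
    (hE : Convex ℝ (E : Set ℝᵈ)) :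
    hullSigma P 𝒩 ≤ (h.isStoppingSet_closedCompl hd hE).history := by
  refine sup_le (MeasurableSpace.generateFrom_le ?_) (MeasurableSpace.generateFrom_le ?_)
  · rintro _ ⟨B, hB, hB', -, rfl⟩
    exact h.measurable_history_hullPolytope hd hE (Polytope.measurableSet_subset hB hB')
  · rintro Z ⟨hZ, hZ0⟩
    refine ⟨by rwa [totalSigma_natFiltration], fun K hK => ?_⟩
    refine .inter ?_ ((h.isStoppingSet_closedCompl hd hE).measurableSet_le K hK)
    exact (measurableSet_natFiltration_iff hK).2 ⟨hZ, ∅, .empty, ae_eq_empty.2 hZ0⟩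

lemma ae_count_diff_closedCompl_eq (h : IsPoissonPointProcess P lam C 𝒩)
    (hE : Convex ℝ (E : Set ℝᵈ)) :
    ∀ᵐ ω ∂P, (𝒩 ω).1 (E \ closedCompl (𝒩 ω)) = interiorCount (𝒩 ω) := by
  filter_upwards [h.ae_frontier_eq_zero hE] with ω hω
  rw [interiorCount, interior_hull_eq_diff_closedCompl hE]
  exact measure_congr_atoms _ fun x hx =>
    and_congr_left fun _ => iff_of_true (atoms_subset _ hx) (atoms_subset_interior hω hx)

lemma condExp_interiorCount (h : IsPoissonPointProcess P lam C 𝒩) (hd : 0 < d)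
    (hE : Convex ℝ (E : Set ℝᵈ)) (k : ℕ) :
    P[Set.indicator {ω | interiorCount (𝒩 ω) = k} (fun _ => (1 : ℝ)) |
        (h.isStoppingSet_closedCompl hd hE).history] =ᵐ[P] fun ω =>
      (poissonMeasure (lam * (volume (hull (𝒩 ω) ∩ C)).toNNReal)).real {k} := by
  have hcount : Set.indicator {ω | interiorCount (𝒩 ω) = k} (fun _ => (1 : ℝ)) =ᵐ[P]
      Set.indicator {ω | (𝒩 ω).1 (E \ closedCompl (𝒩 ω)) = k} fun _ => 1 := by
    filter_upwards [h.ae_count_diff_closedCompl_eq hE] with ω hω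
    simp only [Set.indicator, Set.mem_ofPred_eq, hω]
  filter_upwards [(condExp_congr_ae hcount).trans
    (h.condExp_count_diff (h.isStoppingSet_closedCompl hd hE) k)] with ω hω
  rw [hω, volume_diff_closedCompl_inter hE]

lemma ae_hull_subset (h : IsPoissonPointProcess P lam C 𝒩) (hC : Convex ℝ C) (hC' : IsClosed C) :
    ∀ᵐ ω ∂P, hull (𝒩 ω) ⊆ C := by
  filter_upwards [h.ae_count_eq_zero (E.isCompact.measurableSet.diff hC'.measurableSet)
    Set.sdiff_subset (by simp)] with ω hω
  exact (hull_subset_iff_measure_compl_eq_zero _ hC).2 <|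
    (measure_congr_atoms _ fun x hx => (and_iff_right (atoms_subset _ hx)).symm).trans hω

end IsPoissonPointProcess

lemma IsStoppingSet.history_le_complete {𝒦 : Ω → Compacts ℝᵈ}
    (h : IsStoppingSet E (natFiltration P 𝒩) 𝒦) (hm : m ≤ countSigma 𝒩 E)
    (h𝒦 : ∀ i, MeasurableSet[m] {ω | Disjoint (basisSeq ℝᵈ i) (𝒦 ω)}) {κ : Ω → Measure ℝᵈ}
    (hκ : Measurable[m] κ) (hκ𝒩 : ∀ᵐ ω ∂P, κ ω = (restr (𝒩 ω) (𝒦 ω)).1) :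
    h.history ≤ complete P 𝒩 m := fun A hA => by
  have hchoice (n : ℕ) (I : Finset ℕ) : ∃ S : Set (Measure ℝᵈ), MeasurableSet S ∧
      ∀ᵐ ω ∂P, ω ∈ A ∩ {ω | missed (𝒦 ω : Set ℝᵈ) n = I} ↔
        (restr (𝒩 ω) (removeBasis E I)).1 ∈ S := by
    obtain ⟨-, _, ⟨S, hS, rfl⟩, hAS⟩ := (measurableSet_natFiltration_iff (removeBasis_le E I)).1
      (h.measurableSet_inter_missed_eq monotone_natFiltration hA n I)
    exact ⟨S, hS, hAS.mem_iff⟩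
  choose S hS hAS using hchoice
  rw [complete_eq_inf hm]
  refine MeasurableSpace.measurableSet_inf.2 ⟨totalSigma_natFiltration.le _ hA.1,
    {ω | ∀ᶠ n in atTop, κ ω ∈ S n (missed (𝒦 ω : Set ℝᵈ) n)}, ?_, ?_⟩
  · exact @measurableSet_eventually_mem_missed _ _ _ _ m _ _ _ h𝒦 _ hκ _ hS
  · filter_upwards [hκ𝒩, ae_all_iff.2 fun n => ae_all_iff.2 (hAS n)] with ω hκω hω
    have hA_iff : ∀ᶠ n in atTop, ω ∈ A ↔ κ ω ∈ S n (missed (𝒦 ω : Set ℝᵈ) n) := by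
      filter_upwards [eventually_mem_basisUnion_missed (𝒦 ω).isCompact.isClosed
        (finite_atoms (𝒩 ω))] with n hn
      have hrestr : restr (𝒩 ω) (removeBasis E (missed (𝒦 ω : Set ℝᵈ) n)) =
          restr (𝒩 ω) (𝒦 ω) := restr_congr fun x hx =>
        (and_iff_right (atoms_subset _ hx)).trans ((not_congr (hn x hx)).trans not_not)
      rw [hκω, ← hrestr, ← hω]
      exact (and_iff_left rfl).symm
    exact propext (eventually_const.symm.trans (eventually_congr hA_iff))

lemma IsPoissonPointProcess.history_le_hullSigma [IsProbabilityMeasure P]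
    (h : IsPoissonPointProcess P lam C 𝒩) (hd : 0 < d) (hE : Convex ℝ (E : Set ℝᵈ)) :
    (h.isStoppingSet_closedCompl hd hE).history ≤ hullSigma P 𝒩 := by
  have hpoly : Measurable[MeasurableSpace.comap (fun ω => hullPolytope (𝒩 ω)) inferInstance]
      fun ω => hullPolytope (𝒩 ω) := comap_measurable _
  rw [hullSigma, generateFrom_hull_subset_eq_comap hE]
  refine IsStoppingSet.history_le_complete _ ?_ (fun i => ?_)
    (Polytope.measurable_vertexMeasure.comp hpoly) ?_
  · exact measurable_iff_comap_le.1 (measurable_hullPolytope.comp (measurable_countSigma 𝒩))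
  · simp only [disjoint_closedCompl_iff _ (isOpen_basisSeq i)]
    exact hpoly (Polytope.measurableSet_superset (basisSeq ℝᵈ i ∩ E))
  · filter_upwards [h.ae_frontier_eq_zero hE, h.ae_singleton_le_one hd,
      h.ae_atoms_inter_frontier_hull_subset hE] with ω hω hsimple hext
    exact (restr_closedCompl_eq_vertexMeasure hd hE hω hsimple hext).symm

end HullHistory

end HullPPP

end

theorem mainTheorem5_general {d : ℕ} (hd : 0 < d)
    (E : Compacts (EuclideanSpace ℝ (Fin d)))
    (hE : Convex ℝ (E : Set (EuclideanSpace ℝ (Fin d))))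
    (C : Set (EuclideanSpace ℝ (Fin d))) (lam : ℝ≥0)
    {Ω : Type*} [mΩ : MeasurableSpace Ω] (P : Measure Ω) [IsProbabilityMeasure P]
    (𝒩 : Ω → HullPPP.PointMeasure E) (h𝒩 : HullPPP.IsPoissonPointProcess P lam C 𝒩) :
    ∃ hK : HullPPP.IsStoppingSet E (HullPPP.natFiltration P 𝒩)
        (fun ω => HullPPP.closedCompl (𝒩 ω)),
      hK.history ≤ mΩ ∧
      Measurable[hK.history] (fun ω => HullPPP.boundaryCount (𝒩 ω)) ∧
      Measurable (fun ω => HullPPP.interiorCount (𝒩 ω)) ∧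
      (∀ k : ℕ,
        P[Set.indicator {ω | HullPPP.interiorCount (𝒩 ω) = k} (fun _ => (1 : ℝ)) | hK.history]
          =ᵐ[P] fun ω =>
            (poissonMeasure (lam * (volume (HullPPP.hull (𝒩 ω) ∩ C)).toNNReal)).real {k}) ∧
      hK.history = HullPPP.hullSigma P 𝒩 :=
  ⟨h𝒩.isStoppingSet_closedCompl hd hE, h𝒩.history_le _,
    h𝒩.measurable_history_boundaryCount hd hE,
    (HullPPP.measurable_interiorCount hE).comp h𝒩.measurable, h𝒩.condExp_interiorCount hd hE,
    (h𝒩.history_le_hullSigma hd hE).antisymm (h𝒩.hullSigma_le_history hd hE)⟩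

theorem mainTheorem5 {d : ℕ} (hd : 0 < d)
    (E : Compacts (EuclideanSpace ℝ (Fin d)))
    (hE : Convex ℝ (E : Set (EuclideanSpace ℝ (Fin d))))
    (hE' : (interior (E : Set (EuclideanSpace ℝ (Fin d)))).Nonempty)
    (C : Set (EuclideanSpace ℝ (Fin d))) (hC : Convex ℝ C) (hC' : IsClosed C) (hCE : C ⊆ E)
    (hCvol : 0 < volume C)
    (lam : ℝ≥0) (hlam : 0 < lam)
    {Ω : Type*} [mΩ : MeasurableSpace Ω] (P : Measure Ω) [IsProbabilityMeasure P]
    (𝒩 : Ω → HullPPP.PointMeasure E) (h𝒩 : HullPPP.IsPoissonPointProcess P lam C 𝒩) :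
    ∃ hK : HullPPP.IsStoppingSet E (HullPPP.natFiltration P 𝒩)
        (fun ω => HullPPP.closedCompl (𝒩 ω)),
      hK.history ≤ mΩ ∧
      Measurable[hK.history] (fun ω => HullPPP.boundaryCount (𝒩 ω)) ∧
      Measurable (fun ω => HullPPP.interiorCount (𝒩 ω)) ∧
      (∀ k : ℕ,
        P[Set.indicator {ω | HullPPP.interiorCount (𝒩 ω) = k} (fun _ => (1 : ℝ)) | hK.history]
          =ᵐ[P] fun ω =>
            (poissonMeasure (lam * (volume (HullPPP.hull (𝒩 ω))).toNNReal)).real {k}) ∧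
      hK.history = HullPPP.hullSigma P 𝒩 := by
  obtain ⟨hK, hle, hboundary, hinterior, hcond, hσ⟩ :=
    mainTheorem5_general hd E hE C lam P 𝒩 h𝒩
  refine ⟨hK, hle, hboundary, hinterior, fun k => ?_, hσ⟩
  filter_upwards [hcond k, h𝒩.ae_hull_subset hC hC'] with ω hω hsub
  rwa [Set.inter_eq_left.2 hsub] at hω
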